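/- Let $\{\mu_m\}_{m\in\mathbb N}$ be a sequence of probability distributions (Borel probability measures) on $\mathbb R$, and let $\varphi_m(t)=\int_{\mathbb R}e^{itx}\,\mu_m(dx)$ be the corresponding characteristic functions. Then $\{\mu_m\}$ is computable if and only if $\{\varphi_m\}$ is a computable sequence of functions. Here the notions of computability are those of Pour-El and Richards, all indices and arguments of recursive functions being natural numbers: - A (multi-)sequence of rationals is *recursive* if it has the form $r_i=(-1)^{s(i)}a(i)/b(i)$ with recursive $s,a,b$ and $b(i)\ne 0$ for all $i$. A sequence of complex numbers is recursive if its real and imaginary parts are recursive sequences of rationals. - A (multi-)sequence $\{x_i\}$ of real (complex) numbers is *computable* if there are a recursive sequence $\{r_{i,k}\}$ of rationals (of complex numbers with rational real and imaginary parts) and a recursive function $e(i,N)$ such that $k\ge e(i,N)$ implies $|r_{i,k}-x_i|\le 2^{-N}$. - A sequence $\{f_n\}$ of real- or complex-valued functions on $\mathbb R$ is *computable* if (i) the double sequence $\{f_n(x_m)\}$ is computable for every computable sequence of reals $\{x_m\}$, and (ii) there is a recursive function $\alpha(n,L,k)$ such that $|x-y|<2^{-\alpha(n,L,k)}$ and $|x|,|y|\le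 L$ imply $|f_n(x)-f_n(y)|<2^{-k}$. - $\{\mu_m\}$ is *computable* if the double sequence of reals $\{\int_{\mathbb R}f_n\,d\mu_m\}$ is computable for every computable sequence $\{f_n\}$ of real-valued functions on $\mathbb R$ for which there is a recursive function $L(n)$ such that $f_n(x)=0$ whenever $|x|\ge L(n)$. -/

import Mathlib

open MeasureTheory

namespace PourElRichards

variable {ι : Type*} [Primcodable ι]

/-- A recursive (multi-)sequence of rational numbers `r i = (-1) ^ s i * a i / b i`, where `s`, `a`
and `b` are recursive and `b` has no zeros. The index type is `ℕ`, `ℕ × ℕ`, `(ℕ × ℕ) × ℕ`, ... -/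
def RecursiveRatSeq (r : ι → ℚ) : Prop :=
  ∃ s a b : ι → ℕ, Computable s ∧ Computable a ∧ Computable b ∧
    ∀ i, b i ≠ 0 ∧ r i = (-1) ^ s i * (a i : ℚ) / (b i : ℚ)

/-- A computable (multi-)sequence of reals: the limit of a recursive sequence of rationals `r (i, k)`
as `k → ∞`, the convergence being effective in `k` and `i`. -/
def ComputableRealSeq (x : ι → ℝ) : Prop :=
  ∃ r : ι × ℕ → ℚ, RecursiveRatSeq r ∧
    ∃ e : ι × ℕ → ℕ, Computable e ∧
      ∀ i N k, e (i, N) ≤ k → |(r (i, k) : ℝ) - x i| ≤ (2 : ℝ)⁻¹ ^ N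

/-- A computable (multi-)sequence of complex numbers: the effective limit of a recursive sequence
`r (i, k) + s (i, k) * I` of complex numbers with rational real and imaginary parts. -/
def ComputableComplexSeq (z : ι → ℂ) : Prop :=
  ∃ r s : ι × ℕ → ℚ, RecursiveRatSeq r ∧ RecursiveRatSeq s ∧
    ∃ e : ι × ℕ → ℕ, Computable e ∧
      ∀ i N k, e (i, N) ≤ k →
        ‖((r (i, k) : ℂ) + (s (i, k) : ℂ) * Complex.I) - z i‖ ≤ (2 : ℝ)⁻¹ ^ N

/-- Effective continuity of a sequence of functions on `ℝ`: there is a recursive modulus of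
continuity `α (n, L, k)` for `f n` on `[-L, L]`. -/
def EffectivelyContinuous {E : Type*} [NormedAddCommGroup E] (f : ℕ → ℝ → E) : Prop :=
  ∃ α : ℕ × ℕ × ℕ → ℕ, Computable α ∧
    ∀ (n L k : ℕ) (x y : ℝ), |x - y| < (2 : ℝ)⁻¹ ^ α (n, L, k) → |x| ≤ L → |y| ≤ L →
      ‖f n x - f n y‖ < (2 : ℝ)⁻¹ ^ k

/-- A computable sequence of real-valued functions on `ℝ`: sequentially computable and effectively
continuous. -/
structure ComputableRealFunSeq (f : ℕ → ℝ → ℝ) : Prop where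
  sequentially_computable : ∀ x : ℕ → ℝ, ComputableRealSeq x →
    ComputableRealSeq (fun p : ℕ × ℕ => f p.1 (x p.2))
  effectively_continuous : EffectivelyContinuous f

/-- A computable sequence of complex-valued functions on `ℝ`: sequentially computable and
effectively continuous. -/
structure ComputableComplexFunSeq (f : ℕ → ℝ → ℂ) : Prop where
  sequentially_computable : ∀ x : ℕ → ℝ, ComputableRealSeq x →
    ComputableComplexSeq (fun p : ℕ × ℕ => f p.1 (x p.2))
  effectively_continuous : EffectivelyContinuous f

/-- `f` is a computable sequence of functions with compact support `L`, where `L` is recursive and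
`f n` vanishes at all `x` with `|x| ≥ L n`. -/
def ComputableWithCompactSupport (f : ℕ → ℝ → ℝ) (L : ℕ → ℕ) : Prop :=
  ComputableRealFunSeq f ∧ Computable L ∧ ∀ (n : ℕ) (x : ℝ), (L n : ℝ) ≤ |x| → f n x = 0

/-- A computable sequence of probability distributions: the double sequence of the integrals of
`f n` with respect to `μ m` is computable for every computable sequence `f` of functions with
compact support. -/
def ComputableDistributionSeq (μ : ℕ → ProbabilityMeasure ℝ) : Prop :=
  ∀ (f : ℕ → ℝ → ℝ) (L : ℕ → ℕ), ComputableWithCompactSupport f L →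
    ComputableRealSeq (fun p : ℕ × ℕ => ∫ x, f p.2 x ∂(μ p.1 : Measure ℝ))

end PourElRichards

/-! Both directions reduce to effective limits: by `ComputableRealSeq.of_limit`, a limit of
computable reals is computable once its error is bounded by a computable null sequence. No rate is
needed, since strict inequalities between computable reals can be found by search (`exists_neg`).

From distributions to characteristic functions: the integrals of the cutoffs `cutoff n` are
computable and tend to `1`, so `1 - ∫ cutoff n` is a computable bound for the mass at infinity.
Hence integrals of bounded Lipschitz functions, in particular `cos (t x)` and `sin (t x)`, are
computable by truncation, and the same bound yields a modulus of continuity (`norm_charFun_sub_le`).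

Conversely, the modulus at `0` gives effective tightness (`exists_computable_tight`). A compactly
supported `f` is uniformly close to a finite combination of dyadic tents
(`abs_sum_mul_tent_sub_le`), so it suffices to integrate one tent. Its periodization has an explicit
cosine series with nonnegative, summable coefficients. The partial sums converge at a known rate on
one period and are bounded by `1` everywhere, so with a period long enough for tightness they
approximate the integral (`abs_integral_tentPoly_sub_le`). Their own integrals are finite
combinations of values of the characteristic function at rational points (`integral_tentPoly`). -/

namespace PourElRichards

attribute [fun_prop] Computable
attribute [fun_prop] Computable.id Computable.const Computable.comp Computable.fst Computable.snd
  Computable.pair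

/-! ### Closure properties of recursive functions. -/

section Computable

variable {α β γ ι : Type*} [Primcodable α] [Primcodable β] [Primcodable γ] [Primcodable ι]

@[fun_prop]
theorem computable_fst {f : α → β × γ} (hf : Computable f) : Computable fun i => (f i).1 :=
  Computable.fst.comp hf

@[fun_prop]
theorem computable_snd {f : α → β × γ} (hf : Computable f) : Computable fun i => (f i).2 :=
  Computable.snd.comp hf

variable {f g : ι → ℕ}

@[fun_prop]
theorem computable_add (hf : Computable f) (hg : Computable g) : Computable fun i => f i + g i :=
  Primrec.nat_add.to_comp.comp hf hg

@[fun_prop]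
theorem computable_sub (hf : Computable f) (hg : Computable g) : Computable fun i => f i - g i :=
  Primrec.nat_sub.to_comp.comp hf hg

@[fun_prop]
theorem computable_mul (hf : Computable f) (hg : Computable g) : Computable fun i => f i * g i :=
  Primrec.nat_mul.to_comp.comp hf hg

@[fun_prop]
theorem computable_div (hf : Computable f) (hg : Computable g) : Computable fun i => f i / g i :=
  Primrec.nat_div.to_comp.comp hf hg

@[fun_prop]
theorem computable_mod (hf : Computable f) (hg : Computable g) : Computable fun i => f i % g i :=
  Primrec.nat_mod.to_comp.comp hf hg

@[fun_prop]
theorem computable_pow (hf : Computable f) (hg : Computable g) : Computable fun i => f i ^ g i :=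
  (Primrec₂.unpaired'.1 Nat.Primrec.pow).to_comp.comp hf hg

@[fun_prop]
theorem computable_pair (hf : Computable f) (hg : Computable g) :
    Computable fun i => Nat.pair (f i) (g i) :=
  Primrec₂.natPair.to_comp.comp hf hg

@[fun_prop]
theorem computable_unpair (hf : Computable f) : Computable fun i => Nat.unpair (f i) :=
  Computable.unpair.comp hf

theorem computable_decide_lt (hf : Computable f) (hg : Computable g) :
    Computable fun i => decide (f i < g i) :=
  Primrec.nat_lt.decide.to_comp.comp hf hg

@[fun_prop]
theorem computable_ite_lt {a b : ι → β} (hf : Computable f) (hg : Computable g)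
    (ha : Computable a) (hb : Computable b) :
    Computable fun i => if f i < g i then a i else b i :=
  (Computable.cond (computable_decide_lt hf hg) ha hb).of_eq fun i => by
    by_cases h : f i < g i <;> simp [h]

theorem computable_sum_range {F : ι × ℕ → ℕ} (hF : Computable F) (hf : Computable f) :
    Computable fun i => ∑ j ∈ Finset.range (f i), F (i, j) := by
  have h : Computable fun i => (Nat.rec 0 (fun j s => s + F (i, j)) (f i) : ℕ) :=
    Computable.nat_rec (h := fun i p => p.2 + F (i, p.1)) hf (Computable.const 0)
      (Computable₂.mk (by fun_prop))
  refine h.of_eq fun i => ?_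
  induction f i with
  | zero => simp
  | succ n ih => rw [Finset.sum_range_succ, ← ih]

@[fun_prop]
theorem computable_factorial (hf : Computable f) : Computable fun i => (f i).factorial := by
  have h : Computable fun i => (Nat.rec 1 (fun j s => (j + 1) * s) (f i) : ℕ) :=
    Computable.nat_rec (h := fun i p => (p.1 + 1) * p.2) hf (Computable.const 1)
      (Computable₂.mk (by fun_prop))
  refine h.of_eq fun i => ?_
  induction f i with
  | zero => simp
  | succ n ih => rw [Nat.factorial_succ, ← ih]

/-- Unbounded minimization, which is total because a witness always exists. -/
theorem exists_computable_of_forall_exists {f g : ι × ℕ → ℕ} (hf : Computable f) (hg : Computable g)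
    (h : ∀ i, ∃ n, f (i, n) < g (i, n)) :
    ∃ c : ι → ℕ, Computable c ∧ ∀ i, f (i, c i) < g (i, c i) := by
  have hp : Computable₂ fun (i : ι) (n : ℕ) => decide (f (i, n) < g (i, n)) :=
    computable_decide_lt hf hg
  have hr := Partrec.rfind (p := fun i n => Part.some (decide (f (i, n) < g (i, n)))) hp.partrec₂
  have hd : ∀ i, (Nat.rfind fun n => Part.some (decide (f (i, n) < g (i, n)))).Dom := fun i => by
    obtain ⟨n, hn⟩ := h i
    exact Nat.rfind_dom.2 ⟨n, by simpa using hn, fun _ => trivial⟩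
  refine ⟨fun i => (Nat.rfind fun n => Part.some (decide (f (i, n) < g (i, n)))).get (hd i),
    hr.of_eq_tot fun i => Part.get_mem _, fun i => ?_⟩
  simpa using Nat.rfind_spec (Part.get_mem (hd i))

end Computable

/-! ### Arithmetic and effective limits of computable real sequences. -/

section RealSeq

open Filter Topology

variable {ι κ : Type*} [Primcodable ι] [Primcodable κ] {x y : ι → ℝ}

theorem ComputableRealSeq.of_approx {p q d : ι × ℕ → ℕ} (hp : Computable p) (hq : Computable q)
    (hd : Computable d) (hd0 : ∀ i, d i ≠ 0)
    (h : ∀ i k, |((p (i, k) : ℝ) - q (i, k)) / d (i, k) - x i| ≤ (2 : ℝ)⁻¹ ^ k) :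
    ComputableRealSeq x := by
  refine ⟨fun j => ((p j : ℚ) - q j) / d j,
    ⟨fun j => if p j < q j then 1 else 0, fun j => (p j - q j) + (q j - p j), d,
      by fun_prop, by fun_prop, hd, fun j => ⟨hd0 j, ?_⟩⟩, Prod.snd, by fun_prop, ?_⟩
  · rcases lt_or_ge (p j) (q j) with hj | hj
    · simp [hj, Nat.sub_eq_zero_of_le hj.le, Nat.cast_sub hj.le]
    · simp [not_lt.2 hj, Nat.sub_eq_zero_of_le hj, Nat.cast_sub hj]
  · intro i N k hk
    have := h i k
    push_cast
    exact this.trans (pow_le_pow_of_le_one (by norm_num) (by norm_num) hk)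

/-- A normal form with denominators `2 ^ k` and the identity as modulus. Writing numerators as
differences of naturals keeps signs out of later arguments. -/
theorem ComputableRealSeq.exists_dyadic (hx : ComputableRealSeq x) :
    ∃ p q : ι × ℕ → ℕ, Computable p ∧ Computable q ∧
      ∀ i k, |((p (i, k) : ℝ) - q (i, k)) / 2 ^ k - x i| ≤ (2 : ℝ)⁻¹ ^ k := by
  obtain ⟨r, ⟨s, a, b, hs, ha, hb, hr⟩, e, he, h⟩ := hx
  let j : ι × ℕ → ι × ℕ := fun i => (i.1, e (i.1, i.2 + 1))
  have hj : Computable j := by fun_prop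
  -- The integer nearest to `2 ^ k * a / b`; rounding costs at most `2⁻¹ ^ (k + 1)`, as much as the
  -- approximation chosen by `j`.
  let n : ι × ℕ → ℕ := fun i => (2 * 2 ^ i.2 * a (j i) + b (j i)) / (2 * b (j i))
  have hn : Computable n := by fun_prop
  refine ⟨fun i => if s (j i) % 2 < 1 then n i else 0, fun i => if s (j i) % 2 < 1 then 0 else n i,
    by fun_prop, by fun_prop, fun i k => ?_⟩
  obtain ⟨hb0, hrj⟩ := hr (j (i, k))
  have h1 := h i (k + 1) _ le_rfl
  have hb' : (0 : ℝ) < b (j (i, k)) := by positivity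
  have h2 : |(n (i, k) : ℝ) / 2 ^ k - a (j (i, k)) / b (j (i, k))| ≤ (2 : ℝ)⁻¹ ^ (k + 1) := by
    have hm := Nat.div_add_mod (2 * 2 ^ k * a (j (i, k)) + b (j (i, k))) (2 * b (j (i, k)))
    have hlt := Nat.mod_lt (2 * 2 ^ k * a (j (i, k)) + b (j (i, k)))
      (show 0 < 2 * b (j (i, k)) by omega)
    have hn' : (2 * 2 ^ k * a (j (i, k)) + b (j (i, k))) / (2 * b (j (i, k))) = n (i, k) := rfl
    rw [hn'] at hm
    set m := (2 * 2 ^ k * a (j (i, k)) + b (j (i, k))) % (2 * b (j (i, k)))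
    have hm' : 2 * (b (j (i, k)) : ℝ) * n (i, k) + m = 2 * 2 ^ k * a (j (i, k)) + b (j (i, k)) := by
      exact_mod_cast hm
    have hlt' : (m : ℝ) < 2 * b (j (i, k)) := by exact_mod_cast hlt
    have hm0 : (0 : ℝ) ≤ m := by positivity
    have h2k : (0 : ℝ) < 2 ^ k := by positivity
    have : (n (i, k) : ℝ) / 2 ^ k - a (j (i, k)) / b (j (i, k)) =
        (b (j (i, k)) - m) / (2 * b (j (i, k)) * 2 ^ k) := by
      field_simp
      linarith
    rw [this, inv_pow, pow_succ, abs_div, abs_of_pos (show 0 < 2 * (b (j (i, k)) : ℝ) * 2 ^ k by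
      positivity), div_le_iff₀ (by positivity)]
    have : ((2 : ℝ) ^ k * 2)⁻¹ * (2 * b (j (i, k)) * 2 ^ k) = b (j (i, k)) := by
      field_simp
    rw [this, abs_le]
    constructor <;> linarith
  have hsplit : (2 : ℝ)⁻¹ ^ k = 2⁻¹ ^ (k + 1) + 2⁻¹ ^ (k + 1) := by ring
  rw [hsplit]
  have hrR : (r (i, e (i, k + 1)) : ℝ) = (-1) ^ s (j (i, k)) * a (j (i, k)) / b (j (i, k)) := by
    have : r (i, e (i, k + 1)) = _ := hrj
    rw [this]; push_cast; rfl
  rw [hrR] at h1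
  refine (abs_sub_le _ _ _).trans (add_le_add ?_ h1)
  rcases Nat.mod_two_eq_zero_or_one (s (j (i, k))) with hs | hs
  · have : Even (s (j (i, k))) := Nat.even_iff.2 hs
    simpa [hs, this.neg_one_pow] using h2
  · have : Odd (s (j (i, k))) := Nat.odd_iff.2 hs
    simp only [hs, this.neg_one_pow]
    rw [← abs_neg]
    refine le_of_eq_of_le ?_ h2
    congr 1
    simp
    ring

theorem ComputableRealSeq.comp (hx : ComputableRealSeq x) {g : κ → ι} (hg : Computable g) :
    ComputableRealSeq fun i => x (g i) := by
  obtain ⟨p, q, hp, hq, h⟩ := hx.exists_dyadic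
  exact .of_approx (p := fun i => p (g i.1, i.2)) (q := fun i => q (g i.1, i.2))
    (d := fun i => 2 ^ i.2) (by fun_prop) (by fun_prop) (by fun_prop) (by simp)
    fun i k => by simpa using h (g i) k

theorem ComputableRealSeq.congr (hx : ComputableRealSeq x) (h : ∀ i, x i = y i) :
    ComputableRealSeq y := by
  rwa [← funext h]

theorem ComputableRealSeq.natCast_div {f g : ι → ℕ} (hf : Computable f) (hg : Computable g)
    (hg0 : ∀ i, g i ≠ 0) : ComputableRealSeq fun i => (f i : ℝ) / g i :=
  .of_approx (p := fun i => f i.1) (q := fun _ => 0) (d := fun i => g i.1)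
    (by fun_prop) (by fun_prop) (by fun_prop) (fun i => hg0 i.1) (fun _ _ => by simp)

theorem ComputableRealSeq.natCast {f : ι → ℕ} (hf : Computable f) :
    ComputableRealSeq fun i => (f i : ℝ) :=
  (ComputableRealSeq.natCast_div hf (Computable.const 1) (by simp)).congr (by simp)

theorem ComputableRealSeq.const_nat (n : ℕ) : ComputableRealSeq fun _ : ι => (n : ℝ) :=
  .natCast (Computable.const n)

theorem ComputableRealSeq.neg (hx : ComputableRealSeq x) : ComputableRealSeq fun i => -x i := by
  obtain ⟨p, q, hp, hq, h⟩ := hx.exists_dyadic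
  exact .of_approx hq hp (d := fun i => 2 ^ i.2) (by fun_prop) (by simp) fun i k => by
    rw [← abs_neg]
    convert h i k using 2
    push_cast
    ring

theorem ComputableRealSeq.add (hx : ComputableRealSeq x) (hy : ComputableRealSeq y) :
    ComputableRealSeq fun i => x i + y i := by
  obtain ⟨p, q, hp, hq, h⟩ := hx.exists_dyadic
  obtain ⟨p', q', hp', hq', h'⟩ := hy.exists_dyadic
  refine .of_approx (p := fun i => p (i.1, i.2 + 1) + p' (i.1, i.2 + 1))
    (q := fun i => q (i.1, i.2 + 1) + q' (i.1, i.2 + 1)) (d := fun i => 2 ^ (i.2 + 1))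
    (by fun_prop) (by fun_prop) (by fun_prop) (by simp) fun i k => ?_
  have hsplit : (2 : ℝ)⁻¹ ^ k = 2⁻¹ ^ (k + 1) + 2⁻¹ ^ (k + 1) := by ring
  rw [hsplit]
  refine le_trans ?_ ((abs_add_le _ _).trans (add_le_add (h i (k + 1)) (h' i (k + 1))))
  refine le_of_eq ?_
  congr 1
  push_cast
  ring

theorem ComputableRealSeq.sub (hx : ComputableRealSeq x) (hy : ComputableRealSeq y) :
    ComputableRealSeq fun i => x i - y i :=
  (hx.add hy.neg).congr fun _ => (sub_eq_add_neg _ _).symm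

theorem natCast_absDiff (p q : ℕ) : (((p - q) + (q - p) : ℕ) : ℝ) = |(p : ℝ) - q| := by
  rcases le_total p q with h | h
  · have h' : (p : ℝ) ≤ q := by exact_mod_cast h
    simp [Nat.sub_eq_zero_of_le h, Nat.cast_sub h, abs_of_nonpos (sub_nonpos.2 h')]
  · have h' : (q : ℝ) ≤ p := by exact_mod_cast h
    simp [Nat.sub_eq_zero_of_le h, Nat.cast_sub h, abs_of_nonneg (sub_nonneg.2 h')]

theorem ComputableRealSeq.abs (hx : ComputableRealSeq x) : ComputableRealSeq fun i => |x i| := by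
  obtain ⟨p, q, hp, hq, h⟩ := hx.exists_dyadic
  refine .of_approx (p := fun i => (p i - q i) + (q i - p i)) (q := fun _ => 0)
    (d := fun i => 2 ^ i.2) (by fun_prop) (by fun_prop) (by fun_prop) (by simp) fun i k => ?_
  rw [natCast_absDiff]
  refine le_trans ?_ (h i k)
  refine le_of_eq_of_le ?_ (abs_abs_sub_abs_le_abs_sub _ _)
  simp [abs_div]

theorem ComputableRealSeq.exists_bound (hx : ComputableRealSeq x) :
    ∃ B : ι → ℕ, Computable B ∧ ∀ i, |x i| ≤ B i := by
  obtain ⟨p, q, hp, hq, h⟩ := hx.exists_dyadic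
  refine ⟨fun i => p (i, 0) + q (i, 0) + 1, by fun_prop, fun i => ?_⟩
  have h0 := abs_le.1 (h i 0)
  simp only [pow_zero, div_one] at h0
  have hp0 : (0 : ℝ) ≤ p (i, 0) := by positivity
  have hq0 : (0 : ℝ) ≤ q (i, 0) := by positivity
  rw [abs_le]
  push_cast
  constructor <;> linarith

/-- Precision bookkeeping: a factor `c` is absorbed by `m` extra bits. -/
theorem mul_inv_two_pow_add_le {c : ℝ} {m : ℕ} (hc : c ≤ 2 ^ m) (k : ℕ) :
    c * (2 : ℝ)⁻¹ ^ (k + m) ≤ 2⁻¹ ^ k := by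
  calc c * (2 : ℝ)⁻¹ ^ (k + m) ≤ 2 ^ m * 2⁻¹ ^ (k + m) := by gcongr
    _ = (2 * 2⁻¹) ^ m * 2⁻¹ ^ k := by rw [pow_add, mul_pow]; ring
    _ = 2⁻¹ ^ k := by simp

theorem natCast_le_two_pow (n : ℕ) : (n : ℝ) ≤ 2 ^ n := by
  exact_mod_cast Nat.lt_two_pow_self.le

theorem ComputableRealSeq.mul (hx : ComputableRealSeq x) (hy : ComputableRealSeq y) :
    ComputableRealSeq fun i => x i * y i := by
  obtain ⟨B, hB, hBx⟩ := hx.exists_bound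
  obtain ⟨C, hC, hCy⟩ := hy.exists_bound
  obtain ⟨p, q, hp, hq, h⟩ := hx.exists_dyadic
  obtain ⟨p', q', hp', hq', h'⟩ := hy.exists_dyadic
  -- At precision `K` the product has error at most `(B + C + 1) * 2⁻¹ ^ K`.
  let K : ι × ℕ → ℕ := fun i => i.2 + (B i.1 + C i.1 + 1)
  have hK : Computable K := by fun_prop
  refine .of_approx
    (p := fun i => p (i.1, K i) * p' (i.1, K i) + q (i.1, K i) * q' (i.1, K i))
    (q := fun i => p (i.1, K i) * q' (i.1, K i) + q (i.1, K i) * p' (i.1, K i))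
    (d := fun i => 2 ^ K i * 2 ^ K i)
    (by fun_prop) (by fun_prop) (by fun_prop) (by simp) fun i k => ?_
  have h1 := h i (K (i, k))
  have h2 := h' i (K (i, k))
  have hK1 : (2 : ℝ)⁻¹ ^ K (i, k) ≤ 1 := pow_le_one₀ (by norm_num) (by norm_num)
  have hm : ((B i + C i + 1 : ℕ) : ℝ) * 2⁻¹ ^ K (i, k) ≤ 2⁻¹ ^ k :=
    mul_inv_two_pow_add_le (natCast_le_two_pow _) k
  have hx1 := hBx i
  have hy1 := hCy i
  push_cast at hm ⊢
  set ε := (2 : ℝ)⁻¹ ^ K (i, k)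
  set X := ((p (i, K (i, k)) : ℝ) - q (i, K (i, k))) / 2 ^ K (i, k) with hX
  set Y := ((p' (i, K (i, k)) : ℝ) - q' (i, K (i, k))) / 2 ^ K (i, k) with hY
  have : ((p (i, K (i, k)) : ℝ) * p' (i, K (i, k)) + q (i, K (i, k)) * q' (i, K (i, k)) -
      (p (i, K (i, k)) * q' (i, K (i, k)) + q (i, K (i, k)) * p' (i, K (i, k)))) /
      (2 ^ K (i, k) * 2 ^ K (i, k)) - x i * y i = X * (Y - y i) + (X - x i) * y i := by
    rw [hX, hY]
    field_simp
    ring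
  rw [this]
  have hXb : |X| ≤ B i + 1 := by
    have := abs_sub_abs_le_abs_sub X (x i)
    linarith
  calc |X * (Y - y i) + (X - x i) * y i| ≤ |X| * |Y - y i| + |X - x i| * |y i| := by
        rw [← abs_mul, ← abs_mul]; exact abs_add_le _ _
    _ ≤ (B i + 1) * ε + ε * C i := by gcongr
    _ = (B i + C i + 1) * ε := by ring
    _ ≤ _ := hm

theorem ComputableRealSeq.sum_range {x : ι × ℕ → ℝ} (hx : ComputableRealSeq x) {n : ι → ℕ}
    (hn : Computable n) : ComputableRealSeq fun i => ∑ j ∈ Finset.range (n i), x (i, j) := by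
  obtain ⟨p, q, hp, hq, h⟩ := hx.exists_dyadic
  let K : ι × ℕ → ℕ := fun i => i.2 + n i.1
  have hK : Computable K := by fun_prop
  refine .of_approx
    (p := fun i => ∑ j ∈ Finset.range (n i.1), p ((i.1, j), K i))
    (q := fun i => ∑ j ∈ Finset.range (n i.1), q ((i.1, j), K i))
    (d := fun i => 2 ^ K i)
    (computable_sum_range (F := fun i : (ι × ℕ) × ℕ => p ((i.1.1, i.2), K i.1))
      (by fun_prop) (by fun_prop))
    (computable_sum_range (F := fun i : (ι × ℕ) × ℕ => q ((i.1.1, i.2), K i.1))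
      (by fun_prop) (by fun_prop)) (by fun_prop) (by simp) fun i k => ?_
  push_cast
  rw [← Finset.sum_sub_distrib, Finset.sum_div, ← Finset.sum_sub_distrib]
  calc _ ≤ ∑ j ∈ Finset.range (n i), (2 : ℝ)⁻¹ ^ K (i, k) :=
        (Finset.abs_sum_le_sum_abs _ _).trans (Finset.sum_le_sum fun j _ => h (i, j) _)
    _ = n i * (2 : ℝ)⁻¹ ^ K (i, k) := by simp
    _ ≤ _ := mul_inv_two_pow_add_le (natCast_le_two_pow _) k

theorem ComputableRealSeq.max (hx : ComputableRealSeq x) (hy : ComputableRealSeq y) :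
    ComputableRealSeq fun i => max (x i) (y i) := by
  refine (((hx.add hy).add (hx.sub hy).abs).mul
    (.natCast_div (Computable.const 1) (Computable.const 2) (by simp))).congr fun i => ?_
  rcases le_total (x i) (y i) with h | h
  · rw [max_eq_right h, abs_of_nonpos (sub_nonpos.2 h)]
    push_cast
    ring
  · rw [max_eq_left h, abs_of_nonneg (sub_nonneg.2 h)]
    push_cast
    ring

theorem ComputableRealSeq.min (hx : ComputableRealSeq x) (hy : ComputableRealSeq y) :
    ComputableRealSeq fun i => min (x i) (y i) :=
  (hx.neg.max hy.neg).neg.congr fun i => by rw [max_neg_neg, neg_neg]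

theorem ComputableRealSeq.pow (hx : ComputableRealSeq x) {n : ι → ℕ} (hn : Computable n) :
    ComputableRealSeq fun i => x i ^ n i := by
  obtain ⟨B, hB, hBx⟩ := hx.exists_bound
  obtain ⟨p, q, hp, hq, h⟩ := hx.exists_dyadic
  -- The error is at most `n * (B + 1) ^ n * 2⁻¹ ^ K`, where `n ≤ 2 ^ n` and `B + 1 ≤ 2 ^ B`.
  let K : ι × ℕ → ℕ := fun i => i.2 + (n i.1 + B i.1 * n i.1)
  have hK : Computable K := by fun_prop
  let D : ι × ℕ → ℕ := fun i =>
    ((p (i.1, K i) - q (i.1, K i)) + (q (i.1, K i) - p (i.1, K i))) ^ n i.1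
  have hD : Computable D := by fun_prop
  refine .of_approx
    (p := fun i => if p (i.1, K i) < q (i.1, K i) then if n i.1 % 2 < 1 then D i else 0 else D i)
    (q := fun i => if p (i.1, K i) < q (i.1, K i) then if n i.1 % 2 < 1 then 0 else D i else 0)
    (d := fun i => (2 ^ K i) ^ n i.1)
    (by fun_prop) (by fun_prop) (by fun_prop) (by simp) fun i k => ?_
  have hDv : (D (i, k) : ℝ) = |(p (i, K (i, k)) : ℝ) - q (i, K (i, k))| ^ n i := by
    simp only [D]
    rw [Nat.cast_pow, natCast_absDiff]
  have hpow : ((if p (i, K (i, k)) < q (i, K (i, k)) then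
        if n i % 2 < 1 then D (i, k) else 0 else D (i, k) : ℕ) : ℝ) -
      ((if p (i, K (i, k)) < q (i, K (i, k)) then
        if n i % 2 < 1 then 0 else D (i, k) else 0 : ℕ) : ℝ) =
      ((p (i, K (i, k)) : ℝ) - q (i, K (i, k))) ^ n i := by
    rcases lt_or_ge (p (i, K (i, k))) (q (i, K (i, k))) with hlt | hge
    · have hlt' : (p (i, K (i, k)) : ℝ) < q (i, K (i, k)) := by exact_mod_cast hlt
      rw [abs_of_neg (sub_neg.2 hlt')] at hDv
      rcases Nat.mod_two_eq_zero_or_one (n i) with hs | hs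
      · have : Even (n i) := Nat.even_iff.2 hs
        simp [hlt, hs, hDv, -neg_sub, this.neg_pow]
      · have : Odd (n i) := Nat.odd_iff.2 hs
        simp [hlt, hs, hDv, -neg_sub, this.neg_pow]
    · have hge' : (q (i, K (i, k)) : ℝ) ≤ p (i, K (i, k)) := by exact_mod_cast hge
      rw [abs_of_nonneg (sub_nonneg.2 hge')] at hDv
      simp [not_lt.2 hge, hDv]
  rw [hpow]
  push_cast
  rw [← div_pow]
  have h1 := h i (K (i, k))
  have hK1 : (2 : ℝ)⁻¹ ^ K (i, k) ≤ 1 := pow_le_one₀ (by norm_num) (by norm_num)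
  set X := ((p (i, K (i, k)) : ℝ) - q (i, K (i, k))) / 2 ^ K (i, k) with hX
  have hx1 := hBx i
  have hXb : |X| ≤ B i + 1 := by
    have := abs_sub_abs_le_abs_sub X (x i)
    linarith
  have hB0 : (0 : ℝ) ≤ B i := by positivity
  have hm : (n i : ℝ) * (B i + 1) ^ n i ≤ 2 ^ (n i + B i * n i) := by
    rw [pow_add, pow_mul]
    gcongr
    · exact natCast_le_two_pow _
    · exact_mod_cast Nat.lt_two_pow_self
  calc |X ^ n i - x i ^ n i| ≤ |X - x i| * n i * (Max.max |X| |x i|) ^ (n i - 1) :=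
        abs_pow_sub_pow_le _ _ _
    _ ≤ 2⁻¹ ^ K (i, k) * n i * (B i + 1) ^ (n i - 1) := by
        gcongr
        exact max_le hXb (by linarith)
    _ ≤ 2⁻¹ ^ K (i, k) * n i * (B i + 1) ^ n i := by
        gcongr
        · linarith
        · omega
    _ = (n i * (B i + 1) ^ n i) * 2⁻¹ ^ K (i, k) := by ring
    _ ≤ 2⁻¹ ^ k := mul_inv_two_pow_add_le hm k

/-- Strict negativity is semidecidable: it holds as soon as some `k`-th dyadic approximation lies
below `-2⁻¹ ^ k`, that is `p + 1 < q`. The search runs over coded pairs of `n` and `k`. -/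
theorem ComputableRealSeq.exists_neg {x : ι × ℕ → ℝ} (hx : ComputableRealSeq x)
    (h : ∀ i, ∃ n, x (i, n) < 0) : ∃ c : ι → ℕ, Computable c ∧ ∀ i, x (i, c i) < 0 := by
  obtain ⟨p, q, hp, hq, hpq⟩ := hx.exists_dyadic
  let u : ι × ℕ → (ι × ℕ) × ℕ := fun i => ((i.1, i.2.unpair.1), i.2.unpair.2)
  have hu : Computable u := by fun_prop
  obtain ⟨c, hc, hlt⟩ := exists_computable_of_forall_exists (f := fun i => p (u i) + 1)
    (g := fun i => q (u i)) (by fun_prop) (by fun_prop) (fun i => by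
      obtain ⟨n, hn⟩ := h i
      obtain ⟨k, hk⟩ := exists_pow_lt_of_lt_one (show 0 < -x (i, n) / 2 by linarith)
        (show (2 : ℝ)⁻¹ < 1 by norm_num)
      refine ⟨Nat.pair n k, ?_⟩
      simp only [u, Nat.unpair_pair]
      have h1 := (abs_le.1 (hpq (i, n) k)).2
      have h2 : ((p ((i, n), k) : ℝ) - q ((i, n), k)) / 2 ^ k < -2⁻¹ ^ k := by linarith
      rw [div_lt_iff₀ (by positivity), inv_pow, neg_mul, inv_mul_cancel₀ (by positivity)] at h2
      have : (p ((i, n), k) : ℝ) + 1 < q ((i, n), k) := by linarith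
      exact_mod_cast this)
  refine ⟨fun i => (c i).unpair.1, by fun_prop, fun i => ?_⟩
  have h1 := (abs_le.1 (hpq (i, (c i).unpair.1) (c i).unpair.2)).1
  have h2 : ((p ((i, (c i).unpair.1), (c i).unpair.2) : ℝ) + 1) <
    q ((i, (c i).unpair.1), (c i).unpair.2) := by exact_mod_cast hlt i
  have h3 : ((p ((i, (c i).unpair.1), (c i).unpair.2) : ℝ) -
      q ((i, (c i).unpair.1), (c i).unpair.2)) / 2 ^ (c i).unpair.2 < -2⁻¹ ^ (c i).unpair.2 := by
    rw [div_lt_iff₀ (by positivity), inv_pow, neg_mul, inv_mul_cancel₀ (by positivity)]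
    linarith
  linarith

theorem ComputableRealSeq.inv_two_pow {n : ι → ℕ} (hn : Computable n) :
    ComputableRealSeq fun i => (2 : ℝ)⁻¹ ^ n i :=
  (ComputableRealSeq.natCast_div (Computable.const 1)
    (show Computable fun i => 2 ^ n i by fun_prop) (by simp)).congr (by simp)

theorem ComputableRealSeq.exists_lt_inv_two_pow {b : ι × ℕ → ℝ} (hb : ComputableRealSeq b)
    (hb0 : ∀ i, Tendsto (fun n => b (i, n)) atTop (𝓝 0)) :
    ∃ c : ι × ℕ → ℕ, Computable c ∧ ∀ i k, b (i, c (i, k)) < (2 : ℝ)⁻¹ ^ k := by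
  have hg : Computable fun i : (ι × ℕ) × ℕ => (i.1.1, i.2) := by fun_prop
  obtain ⟨c, hc, h⟩ := ((hb.comp hg).sub (.inv_two_pow (n := fun i : (ι × ℕ) × ℕ => i.1.2)
    (by fun_prop))).exists_neg (fun i => by
      obtain ⟨n, hn⟩ := ((hb0 i.1).eventually_lt_const
        (show (0 : ℝ) < 2⁻¹ ^ i.2 by positivity)).exists
      exact ⟨n, sub_neg.2 hn⟩)
  exact ⟨c, hc, fun i k => sub_neg.1 (h (i, k))⟩

/-- An effective limit of a computable sequence is computable: it suffices that the error is
bounded by a computable null sequence. -/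
theorem ComputableRealSeq.of_limit {y b : ι × ℕ → ℝ} (hy : ComputableRealSeq y)
    (hb : ComputableRealSeq b) (h : ∀ i n, |y (i, n) - x i| ≤ b (i, n))
    (hb0 : ∀ i, Tendsto (fun n => b (i, n)) atTop (𝓝 0)) : ComputableRealSeq x := by
  obtain ⟨c, hc, hlt⟩ := hb.exists_lt_inv_two_pow hb0
  obtain ⟨p, q, hp, hq, hpq⟩ := hy.exists_dyadic
  refine .of_approx (p := fun i => p ((i.1, c (i.1, i.2 + 1)), i.2 + 1))
    (q := fun i => q ((i.1, c (i.1, i.2 + 1)), i.2 + 1)) (d := fun i => 2 ^ (i.2 + 1))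
    (by fun_prop) (by fun_prop) (by fun_prop) (by simp) fun i k => ?_
  have hsplit : (2 : ℝ)⁻¹ ^ k = 2⁻¹ ^ (k + 1) + 2⁻¹ ^ (k + 1) := by ring
  rw [hsplit]
  push_cast
  exact (abs_sub_le _ _ _).trans (add_le_add (hpq _ _) ((h _ _).trans (hlt _ _).le))

theorem tendsto_inv_two_pow : Tendsto (fun n : ℕ => (2 : ℝ)⁻¹ ^ n) atTop (𝓝 0) :=
  tendsto_pow_atTop_nhds_zero_of_lt_one (by norm_num) (by norm_num)

end RealSeq

/-! ### Computability of cosine and sine. -/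

section Trigonometric

open Filter Topology

variable {ι : Type*} [Primcodable ι] {x y : ι → ℝ}

theorem ComputableRealSeq.of_power_series {c : ℕ → ℝ} (hc : ComputableRealSeq c)
    (hx : ComputableRealSeq x) (h : ∀ i (n : ℕ), |x i| / n.succ ≤ 1 / 2 →
      |(∑ m ∈ Finset.range n, c m * (x i ^ m / m.factorial)) - y i| ≤
        |x i| ^ n / n.factorial * 2) : ComputableRealSeq y := by
  obtain ⟨B, hB, hBx⟩ := hx.exists_bound
  have hterm : ComputableRealSeq fun i : (ι × ℕ) × ℕ =>
      c i.2 * (x i.1.1 ^ i.2 * ((1 : ℕ) / (i.2.factorial : ℕ))) :=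
    (hc.comp (show Computable fun i : (ι × ℕ) × ℕ => i.2 by fun_prop)).mul
      (((hx.comp (show Computable fun i : (ι × ℕ) × ℕ => i.1.1 by fun_prop)).pow
        (show Computable fun i : (ι × ℕ) × ℕ => i.2 by fun_prop)).mul
      (.natCast_div (by fun_prop) (by fun_prop) fun i => i.2.factorial_ne_zero))
  have hb : ComputableRealSeq fun i : ι × ℕ => ((B i.1 ^ (i.2 + 2 * B i.1) * 2 : ℕ) : ℝ) /
      ((i.2 + 2 * B i.1).factorial : ℕ) :=
    .natCast_div (by fun_prop) (by fun_prop) fun i => Nat.factorial_ne_zero _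
  -- Starting at `2 * B` terms ensures `|x| / (n + 1) ≤ 1 / 2`, the range where the remainder
  -- estimate is available.
  refine (hterm.sum_range (n := fun i => i.2 + 2 * B i.1) (by fun_prop)).of_limit hb ?_ ?_
  · intro i n
    have h0 := h i (n + 2 * B i) (by
      rw [div_le_iff₀ (by positivity)]
      push_cast
      have := hBx i
      have : (0 : ℝ) ≤ n := by positivity
      linarith)
    have hle : |x i| ^ (n + 2 * B i) / (n + 2 * B i).factorial * 2 ≤
        (B i : ℝ) ^ (n + 2 * B i) / (n + 2 * B i).factorial * 2 := by
      gcongr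
      exact hBx i
    refine le_trans (le_of_eq ?_) (h0.trans (hle.trans (le_of_eq ?_)))
    · simp [div_eq_mul_inv]
    · push_cast
      ring
  · intro i
    have := ((FloorSemiring.tendsto_pow_div_factorial_atTop (B i : ℝ)).comp
      (tendsto_add_atTop_nat (2 * B i))).mul_const 2
    rw [zero_mul] at this
    refine this.congr fun n => ?_
    simp only [Function.comp_apply]
    push_cast
    ring

theorem computableRealSeq_re_I_pow : ComputableRealSeq fun m : ℕ => (Complex.I ^ m).re := by
  refine ((ComputableRealSeq.natCast (f := fun m : ℕ => if m % 4 < 1 then 1 else 0)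
    (by fun_prop)).sub (ComputableRealSeq.natCast
      (f := fun m : ℕ => if m % 4 < 2 then 0 else if m % 4 < 3 then 1 else 0)
      (by fun_prop))).congr fun m => ?_
  rw [Complex.I_pow_eq_pow_mod]
  have := Nat.mod_lt m (show 4 > 0 by norm_num)
  interval_cases m % 4 <;> simp [pow_succ]

theorem computableRealSeq_im_I_pow : ComputableRealSeq fun m : ℕ => (Complex.I ^ m).im :=
  (computableRealSeq_re_I_pow.comp (show Computable fun m => m + 3 by fun_prop)).congr fun m => by
    simp [pow_add, Complex.I_pow_three]

theorem exp_mul_I_sum_term (t : ℝ) (m : ℕ) :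
    ((t : ℂ) * Complex.I) ^ m / m.factorial =
      Complex.I ^ m * ((t ^ m / m.factorial : ℝ) : ℂ) := by
  push_cast
  rw [mul_pow]
  ring

theorem ComputableRealSeq.cos (hx : ComputableRealSeq x) :
    ComputableRealSeq fun i => Real.cos (x i) := by
  refine .of_power_series computableRealSeq_re_I_pow hx fun i n hn => ?_
  have h := Complex.exp_bound' (x := (x i : ℂ) * Complex.I) (n := n) (by simpa using hn)
  rw [norm_sub_rev] at h
  refine le_of_eq_of_le ?_ ((Complex.abs_re_le_norm _).trans (h.trans (by simp)))
  simp only [exp_mul_I_sum_term, Complex.sub_re, Complex.re_sum, Complex.exp_ofReal_mul_I_re,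
    Complex.re_mul_ofReal]

theorem ComputableRealSeq.sin (hx : ComputableRealSeq x) :
    ComputableRealSeq fun i => Real.sin (x i) := by
  refine .of_power_series computableRealSeq_im_I_pow hx fun i n hn => ?_
  have h := Complex.exp_bound' (x := (x i : ℂ) * Complex.I) (n := n) (by simpa using hn)
  rw [norm_sub_rev] at h
  refine le_of_eq_of_le ?_ ((Complex.abs_im_le_norm _).trans (h.trans (by simp)))
  simp only [exp_mul_I_sum_term, Complex.sub_im, Complex.im_sum, Complex.exp_ofReal_mul_I_im,
    Complex.im_mul_ofReal]

end Trigonometric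

/-! ### Complex sequences through real and imaginary parts. -/

section Complex

variable {ι : Type*} [Primcodable ι] {z : ι → ℂ}

theorem ComputableComplexSeq.re (hz : ComputableComplexSeq z) :
    ComputableRealSeq fun i => (z i).re := by
  obtain ⟨r, s, hr, -, e, he, h⟩ := hz
  refine ⟨r, hr, e, he, fun i N k hk => le_of_eq_of_le ?_ ((Complex.abs_re_le_norm _).trans
    (h i N k hk))⟩
  simp

theorem ComputableComplexSeq.im (hz : ComputableComplexSeq z) :
    ComputableRealSeq fun i => (z i).im := by
  obtain ⟨r, s, -, hs, e, he, h⟩ := hz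
  refine ⟨s, hs, e, he, fun i N k hk => le_of_eq_of_le ?_ ((Complex.abs_im_le_norm _).trans
    (h i N k hk))⟩
  simp

theorem ComputableComplexSeq.of_re_im (hre : ComputableRealSeq fun i => (z i).re)
    (him : ComputableRealSeq fun i => (z i).im) : ComputableComplexSeq z := by
  obtain ⟨r, hr, e, he, h⟩ := hre
  obtain ⟨s, hs, e', he', h'⟩ := him
  refine ⟨r, s, hr, hs, fun i => e (i.1, i.2 + 1) + e' (i.1, i.2 + 1), by fun_prop,
    fun i N k hk => ?_⟩
  dsimp only at hk
  have hsplit : (2 : ℝ)⁻¹ ^ N = 2⁻¹ ^ (N + 1) + 2⁻¹ ^ (N + 1) := by ring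
  rw [hsplit]
  refine (Complex.norm_le_abs_re_add_abs_im _).trans (add_le_add ?_ ?_)
  · simpa using h i (N + 1) k (by omega)
  · simpa using h' i (N + 1) k (by omega)

end Complex

/-! ### Effective continuity from Lipschitz bounds. -/

section Lipschitz

variable {E : Type*} [NormedAddCommGroup E]

theorem effectivelyContinuous_of_lipschitz {f : ℕ → ℝ → E} {B : ℕ → ℕ} (hB : Computable B)
    (h : ∀ n x y, ‖f n x - f n y‖ ≤ B n * |x - y|) : EffectivelyContinuous f := by
  refine ⟨fun p => p.2.2 + B p.1, by fun_prop, fun n L k x y hxy _ _ => ?_⟩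
  calc ‖f n x - f n y‖ ≤ B n * |x - y| := h n x y
    _ ≤ 2 ^ B n * |x - y| := by gcongr; exact natCast_le_two_pow _
    _ < 2 ^ B n * 2⁻¹ ^ (k + B n) := by gcongr
    _ ≤ 2⁻¹ ^ k := mul_inv_two_pow_add_le le_rfl k

end Lipschitz

/-! ### Cutoff functions and the mass they capture. -/

section Cutoff

open Filter Topology

/-- The continuous piecewise linear function that is `1` on `[-n, n]` and vanishes outside
`[-(n + 1), n + 1]`. -/
noncomputable def cutoff (n : ℕ) (t : ℝ) : ℝ := max 0 (min 1 (n + 1 - |t|))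

theorem cutoff_nonneg (n : ℕ) (t : ℝ) : 0 ≤ cutoff n t := le_max_left _ _

theorem cutoff_le_one (n : ℕ) (t : ℝ) : cutoff n t ≤ 1 := max_le zero_le_one (min_le_left _ _)

theorem abs_cutoff_le_one (n : ℕ) (t : ℝ) : |cutoff n t| ≤ 1 := by
  rw [abs_of_nonneg (cutoff_nonneg n t)]
  exact cutoff_le_one n t

theorem cutoff_eq_one {n : ℕ} {t : ℝ} (h : |t| ≤ n) : cutoff n t = 1 := by
  rw [cutoff, min_eq_left (by linarith), max_eq_right zero_le_one]

theorem cutoff_eq_zero {n : ℕ} {t : ℝ} (h : n + 1 ≤ |t|) : cutoff n t = 0 := by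
  rw [cutoff, max_eq_left ((min_le_right _ _).trans (by linarith))]

@[fun_prop]
theorem continuous_cutoff (n : ℕ) : Continuous (cutoff n) := by
  unfold cutoff
  fun_prop

theorem abs_cutoff_sub_cutoff_le (n : ℕ) (s t : ℝ) : |cutoff n s - cutoff n t| ≤ |s - t| := by
  have h := abs_abs_sub_abs_le_abs_sub s t
  have h1 := abs_max_sub_max_le_abs (min 1 (n + 1 - |s|)) (min 1 (n + 1 - |t|)) 0
  have h2 := abs_min_sub_min_le_max 1 (n + 1 - |s|) 1 (n + 1 - |t|)
  rw [sub_self, abs_zero, max_eq_right (abs_nonneg _)] at h2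
  rw [max_comm _ 0, max_comm _ 0] at h1
  refine h1.trans (h2.trans (le_of_eq_of_le ?_ h))
  rw [← abs_neg]
  congr 1
  ring

theorem ComputableRealSeq.cutoff {ι : Type*} [Primcodable ι] {x : ι → ℝ}
    (hx : ComputableRealSeq x) {n : ι → ℕ} (hn : Computable n) :
    ComputableRealSeq fun i => cutoff (n i) (x i) :=
  ((ComputableRealSeq.const_nat 0).max ((ComputableRealSeq.const_nat 1).min
    (((ComputableRealSeq.natCast hn).add (.const_nat 1)).sub hx.abs))).congr fun i => by
      simp [PourElRichards.cutoff]

theorem integrable_of_abs_le {μ : Measure ℝ} [IsFiniteMeasure μ] {g : ℝ → ℝ} {C : ℝ}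
    (hg : Continuous g) (h : ∀ t, |g t| ≤ C) : Integrable g μ :=
  .of_bound hg.aestronglyMeasurable C (.of_forall h)

theorem tendsto_integral_cutoff (μ : Measure ℝ) [IsProbabilityMeasure μ] :
    Tendsto (fun n => ∫ t, cutoff n t ∂μ) atTop (𝓝 1) := by
  have h : Tendsto (fun n => ∫ t, cutoff n t ∂μ) atTop (𝓝 (∫ _, (1 : ℝ) ∂μ)) := by
    refine tendsto_integral_of_dominated_convergence (fun _ => 1)
      (fun n => (continuous_cutoff n).aestronglyMeasurable) (integrable_const _)
      (fun n => .of_forall fun t => abs_cutoff_le_one n t) (.of_forall fun t => ?_)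
    refine tendsto_const_nhds.congr' ?_
    obtain ⟨N, hN⟩ := exists_nat_ge |t|
    filter_upwards [eventually_ge_atTop N] with n hn
    exact (cutoff_eq_one (hN.trans (by exact_mod_cast hn))).symm
  simpa using h

end Cutoff

/-! ### Estimates for characteristic functions. -/

section CharFun

variable (μ : Measure ℝ) [IsProbabilityMeasure μ]

theorem integrable_exp_mul_I (t : ℝ) :
    Integrable (fun x : ℝ => Complex.exp (t * x * Complex.I)) μ :=
  .of_bound (by fun_prop) 1 (.of_forall fun x => by
    rw [← Complex.ofReal_mul, Complex.norm_exp_ofReal_mul_I])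

theorem re_charFun (t : ℝ) : (charFun μ t).re = ∫ x, Real.cos (t * x) ∂μ := by
  rw [charFun_apply_real, ← Complex.reCLM_apply,
    ← Complex.reCLM.integral_comp_comm (integrable_exp_mul_I μ t)]
  refine integral_congr_ae (.of_forall fun x => ?_)
  simp only [Complex.reCLM_apply]
  rw [← Complex.ofReal_mul, Complex.exp_ofReal_mul_I_re]

theorem im_charFun (t : ℝ) : (charFun μ t).im = ∫ x, Real.sin (t * x) ∂μ := by
  rw [charFun_apply_real, ← Complex.imCLM_apply,
    ← Complex.imCLM.integral_comp_comm (integrable_exp_mul_I μ t)]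
  refine integral_congr_ae (.of_forall fun x => ?_)
  simp only [Complex.imCLM_apply]
  rw [← Complex.ofReal_mul, Complex.exp_ofReal_mul_I_im]

theorem norm_exp_sub_exp_le (s t x : ℝ) :
    ‖Complex.exp (s * x * Complex.I) - Complex.exp (t * x * Complex.I)‖ ≤ |s - t| * |x| := by
  have h : Complex.exp (s * x * Complex.I) - Complex.exp (t * x * Complex.I) =
      Complex.exp ((t * x : ℝ) * Complex.I) *
        (Complex.exp (Complex.I * ((s - t) * x : ℝ)) - 1) := by
    rw [mul_sub, ← Complex.exp_add]
    push_cast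
    ring_nf
  rw [h, norm_mul, Complex.norm_exp_ofReal_mul_I, one_mul, ← abs_mul]
  exact Real.norm_exp_I_mul_ofReal_sub_one_le

/-- For `|x| ≤ n + 1` the exponentials differ by at most `|s - t| * |x|`; beyond that the cutoff
vanishes and the trivial bound `2` applies. A cutoff integral replaces a tail probability because it
is computable. -/
theorem norm_charFun_sub_le (n : ℕ) (s t : ℝ) :
    ‖charFun μ s - charFun μ t‖ ≤ |s - t| * (n + 1) + 2 * (1 - ∫ x, cutoff n x ∂μ) := by
  have hw : Integrable (cutoff n) μ :=
    integrable_of_abs_le (continuous_cutoff n) (abs_cutoff_le_one n)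
  have hw' : Integrable (fun x => 2 * (1 - cutoff n x)) μ :=
    ((integrable_const 1).sub hw).const_mul 2
  rw [charFun_apply_real, charFun_apply_real,
    ← integral_sub (integrable_exp_mul_I μ s) (integrable_exp_mul_I μ t)]
  calc _ ≤ ∫ x, ‖Complex.exp (s * x * Complex.I) - Complex.exp (t * x * Complex.I)‖ ∂μ :=
        norm_integral_le_integral_norm _
    _ ≤ ∫ x, (|s - t| * (n + 1) + 2 * (1 - cutoff n x)) ∂μ := by
        refine integral_mono ((integrable_exp_mul_I μ s).sub (integrable_exp_mul_I μ t)).norm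
          ((integrable_const _).add hw') fun x => ?_
        rcases le_total |x| (n + 1) with hx | hx
        · have := cutoff_le_one n x
          calc _ ≤ |s - t| * |x| := norm_exp_sub_exp_le s t x
            _ ≤ |s - t| * (n + 1) := by gcongr
            _ ≤ _ := by linarith
        · dsimp only
          rw [cutoff_eq_zero hx]
          have h1 := norm_sub_le (Complex.exp (s * x * Complex.I))
            (Complex.exp (t * x * Complex.I))
          rw [← Complex.ofReal_mul, ← Complex.ofReal_mul, Complex.norm_exp_ofReal_mul_I,
            Complex.norm_exp_ofReal_mul_I] at h1
          have : 0 ≤ |s - t| * (n + 1) := by positivity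
          push_cast at h1
          linarith
    _ = _ := by
        rw [integral_add (integrable_const _) hw', integral_const, integral_const_mul,
          integral_sub (integrable_const _) hw]
        simp

end CharFun

/-! ### Computable distributions have computable characteristic functions. -/

section Forward

open Filter Topology

variable {μ : ℕ → ProbabilityMeasure ℝ}

theorem ComputableDistributionSeq.integral_cutoff (hμ : ComputableDistributionSeq μ) :
    ComputableRealSeq fun p : ℕ × ℕ => ∫ x, cutoff p.2 x ∂(μ p.1 : Measure ℝ) := by
  refine hμ cutoff (· + 1) ⟨⟨fun x hx => ?_, ?_⟩, by fun_prop, fun n x h => ?_⟩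
  · exact (hx.comp (g := Prod.snd) (by fun_prop)).cutoff (n := Prod.fst) (by fun_prop)
  · exact effectivelyContinuous_of_lipschitz (Computable.const 1) fun n x y => by
      simpa using abs_cutoff_sub_cutoff_le n x y
  · exact cutoff_eq_zero (by exact_mod_cast h)

/-- Replacing `g` by `g * cutoff n` changes the integral by at most `1 - ∫ cutoff n`, a computable
null sequence. -/
theorem ComputableDistributionSeq.integral_of_abs_le_one (hμ : ComputableDistributionSeq μ)
    {g : ℕ → ℝ → ℝ} {B : ℕ → ℕ} (hB : Computable B)
    (hg : ∀ x : ℕ → ℝ, ComputableRealSeq x → ComputableRealSeq fun p : ℕ × ℕ => g p.1 (x p.2))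
    (hgB : ∀ n s t, |g n s - g n t| ≤ B n * |s - t|) (hg1 : ∀ n t, |g n t| ≤ 1) :
    ComputableRealSeq fun p : ℕ × ℕ => ∫ x, g p.2 x ∂(μ p.1 : Measure ℝ) := by
  have hcont : ∀ n, Continuous (g n) := fun n =>
    (LipschitzWith.of_dist_le_mul (K := (B n : NNReal)) fun s t => by
      simpa [Real.dist_eq] using hgB n s t).continuous
  have hI := hμ (fun n t => g n.unpair.1 t * cutoff n.unpair.2 t) (fun n => n.unpair.2 + 1)
    ⟨⟨fun x hx => ?_, ?_⟩, by fun_prop, fun n x h => ?_⟩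
  · refine (hI.comp (κ := (ℕ × ℕ) × ℕ) (g := fun i => (i.1.1, Nat.pair i.1.2 i.2))
      (by fun_prop)).of_limit ((ComputableRealSeq.const_nat 1).sub (hμ.integral_cutoff.comp
        (g := fun i : (ℕ × ℕ) × ℕ => (i.1.1, i.2)) (by fun_prop))) ?_ ?_
    · rintro ⟨m, j⟩ n
      simp only [Nat.unpair_pair, Nat.cast_one]
      have hw : Integrable (cutoff n) (μ m : Measure ℝ) :=
        integrable_of_abs_le (continuous_cutoff n) (abs_cutoff_le_one n)
      have hgi : Integrable (g j) (μ m : Measure ℝ) := integrable_of_abs_le (hcont j) (hg1 j)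
      have hgw : Integrable (fun t => g j t * cutoff n t) (μ m : Measure ℝ) :=
        integrable_of_abs_le (C := 1) ((hcont j).mul (continuous_cutoff n)) fun t => by
          rw [abs_mul]
          exact mul_le_one₀ (hg1 j t) (abs_nonneg _) (abs_cutoff_le_one n t)
      have h1 : (1 : ℝ) - ∫ t, cutoff n t ∂(μ m : Measure ℝ) =
          ∫ t, (1 - cutoff n t) ∂(μ m : Measure ℝ) := by
        rw [integral_sub (integrable_const _) hw]
        simp
      rw [h1, ← integral_sub hgw hgi, ← Real.norm_eq_abs]
      refine norm_integral_le_of_norm_le ((integrable_const _).sub hw) (.of_forall fun t => ?_)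
      have : g j t * cutoff n t - g j t = -(g j t * (1 - cutoff n t)) := by ring
      have h0 : 0 ≤ 1 - cutoff n t := sub_nonneg.2 (cutoff_le_one n t)
      rw [this, norm_neg, norm_mul, Real.norm_eq_abs, Real.norm_eq_abs, abs_of_nonneg h0]
      exact mul_le_of_le_one_left h0 (hg1 j t)
    · rintro ⟨m, j⟩
      simpa using (tendsto_integral_cutoff (μ m : Measure ℝ)).const_sub 1
  · exact ((hg x hx).comp (g := fun p : ℕ × ℕ => (p.1.unpair.1, p.2)) (by fun_prop)).mul
      ((hx.comp (g := Prod.snd) (by fun_prop)).cutoff (n := fun p : ℕ × ℕ => p.1.unpair.2)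
        (by fun_prop))
  · refine effectivelyContinuous_of_lipschitz (B := fun n => B n.unpair.1 + 1) (by fun_prop)
      fun n s t => ?_
    have : g n.unpair.1 s * cutoff n.unpair.2 s - g n.unpair.1 t * cutoff n.unpair.2 t =
      (g n.unpair.1 s - g n.unpair.1 t) * cutoff n.unpair.2 s +
        g n.unpair.1 t * (cutoff n.unpair.2 s - cutoff n.unpair.2 t) := by ring
    rw [this]
    refine (norm_add_le _ _).trans ?_
    rw [norm_mul, norm_mul]
    simp only [Real.norm_eq_abs]
    calc _ ≤ (B n.unpair.1 * |s - t|) * 1 + 1 * |s - t| := by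
          exact add_le_add
            (mul_le_mul (hgB _ s t) (abs_cutoff_le_one _ _) (abs_nonneg _) (by positivity))
            (mul_le_mul (hg1 _ t) (abs_cutoff_sub_cutoff_le _ s t) (abs_nonneg _) zero_le_one)
      _ = _ := by push_cast; ring
  · dsimp only
    rw [cutoff_eq_zero (by exact_mod_cast h), mul_zero]

theorem ComputableDistributionSeq.computable_charFun (hμ : ComputableDistributionSeq μ) :
    ComputableComplexFunSeq fun m t => charFun (μ m : Measure ℝ) t := by
  refine ⟨fun x hx => ?_, ?_⟩
  · obtain ⟨B, hB, hBx⟩ := hx.exists_bound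
    have hmul : ∀ y : ℕ → ℝ, ComputableRealSeq y →
        ComputableRealSeq fun p : ℕ × ℕ => x p.1 * y p.2 := fun y hy =>
      (hx.comp (g := Prod.fst) (by fun_prop)).mul (hy.comp (g := Prod.snd) (by fun_prop))
    have hle : ∀ n s t : _, |x n * s - x n * t| ≤ B n * |s - t| := fun n s t => by
      rw [← mul_sub, abs_mul]
      gcongr
      exact hBx n
    refine .of_re_im ?_ ?_
    · simp only [re_charFun]
      exact hμ.integral_of_abs_le_one (g := fun n t => Real.cos (x n * t)) hB
        (fun y hy => (hmul y hy).cos)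
        (fun n s t => (Real.abs_cos_sub_cos_le _ _).trans (hle n s t))
        fun n t => Real.abs_cos_le_one _
    · simp only [im_charFun]
      exact hμ.integral_of_abs_le_one (g := fun n t => Real.sin (x n * t)) hB
        (fun y hy => (hmul y hy).sin)
        (fun n s t => (Real.abs_sin_sub_sin_le _ _).trans (hle n s t))
        fun n t => Real.abs_sin_le_one _
  · obtain ⟨c, hc, hlt⟩ := ((ComputableRealSeq.const_nat 1).sub
      hμ.integral_cutoff).exists_lt_inv_two_pow (fun m => by
        simpa using (tendsto_integral_cutoff (μ m : Measure ℝ)).const_sub 1)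
    -- With cutoff index `c`, the tail costs less than `2 * 2⁻¹ ^ (k + 2)` and the factor `c + 1 ≤ 2
    -- ^ (c + 1)` costs `c + 1` bits. The modulus is uniform in `L`.
    refine ⟨fun p => p.2.2 + 1 + (c (p.1, p.2.2 + 2) + 1), by fun_prop,
      fun m L k s t hst _ _ => ?_⟩
    have h1 := norm_charFun_sub_le (μ m : Measure ℝ) (c (m, k + 2)) s t
    have h2 := hlt m (k + 2)
    have h3 : |s - t| * (c (m, k + 2) + 1) ≤ 2⁻¹ ^ (k + 1) := by
      refine le_trans ?_ (mul_inv_two_pow_add_le (natCast_le_two_pow (c (m, k + 2) + 1)) (k + 1))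
      push_cast
      rw [mul_comm]
      gcongr
    have h4 : (2 : ℝ)⁻¹ ^ k = 2⁻¹ ^ (k + 1) + 2 * 2⁻¹ ^ (k + 2) := by ring
    push_cast at h2
    linarith

end Forward

/-! ### Fourier series of the periodic tent, and computability of `π`. -/

section Series

open Filter Topology Real

/-- The Fourier series of the second Bernoulli polynomial, evaluated at `|y| / (2 * π)`. -/
theorem hasSum_cos_div_sq {y : ℝ} (hy : |y| ≤ 2 * π) :
    HasSum (fun n : ℕ => 1 / (n : ℝ) ^ 2 * cos (n * y)) (y ^ 2 / 4 - π * |y| / 2 + π ^ 2 / 6) := by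
  have hx : |y| / (2 * π) ∈ Set.Icc (0 : ℝ) 1 :=
    ⟨by positivity, (div_le_one (by positivity)).2 hy⟩
  have h := hasSum_one_div_nat_pow_mul_cos one_ne_zero hx
  simp only [Nat.mul_one] at h
  have hB : (Polynomial.map (algebraMap ℚ ℝ) (Polynomial.bernoulli 2)).eval
      (|y| / (2 * π)) = (|y| / (2 * π)) ^ 2 - |y| / (2 * π) + 6⁻¹ := bernoulliFun_two _
  rw [hB] at h
  convert h using 1
  · funext n
    have : 2 * π * n * (|y| / (2 * π)) = |n * y| := by
      rw [abs_mul, Nat.abs_cast]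
      field_simp
    rw [this, cos_abs]
  · rw [← sq_abs y]
    simp [Nat.factorial, -sq_abs]
    field_simp
    ring

theorem abs_add_add_abs_sub (a y : ℝ) (ha : 0 ≤ a) :
    |y + a| + |y - a| = 2 * |y| + 2 * max 0 (a - |y|) := by
  rcases le_total 0 (a - |y|) with h | h
  · have := abs_le.1 (sub_nonneg.1 h)
    rw [max_eq_right h, abs_of_nonneg (by linarith), abs_of_nonpos (by linarith)]
    ring
  · rw [max_eq_left h]
    rcases le_total 0 y with hy | hy
    · rw [abs_of_nonneg hy] at h ⊢
      rw [abs_of_nonneg (by linarith), abs_of_nonneg (by linarith)]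
      ring
    · rw [abs_of_nonpos hy] at h ⊢
      rw [abs_of_nonpos (by linarith), abs_of_nonpos (by linarith)]
      ring

/-- The Fourier coefficients (up to normalization) of a periodic triangle function. -/
noncomputable def tentCoeff (a : ℝ) (k : ℕ) : ℝ := 2 * (1 - cos ((k + 1) * a)) / ((k : ℝ) + 1) ^ 2

theorem tentCoeff_nonneg (a : ℝ) (k : ℕ) : 0 ≤ tentCoeff a k := by
  have := cos_le_one ((k + 1) * a)
  have h : 0 ≤ 1 - cos ((k + 1) * a) := by linarith
  unfold tentCoeff
  positivity

theorem tentCoeff_le (a : ℝ) (k : ℕ) : tentCoeff a k ≤ 4 / ((k : ℝ) + 1) ^ 2 := by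
  have := neg_one_le_cos ((k + 1) * a)
  unfold tentCoeff
  gcongr
  linarith

/-- Take the second difference `2 F(y) - F(y + a) - F(y - a)` of the series in `hasSum_cos_div_sq`.
It multiplies the `n`-th coefficient by `2 * (1 - cos (n * a))`, turns `|y|` into a tent and `y ^ 2`
into a constant. -/
theorem hasSum_tentCoeff_mul_cos {a y : ℝ} (ha : 0 ≤ a) (ha' : a ≤ π) (hy : |y| ≤ π) :
    HasSum (fun k : ℕ => tentCoeff a k * cos ((k + 1) * y))
      (π * max 0 (a - |y|) - a ^ 2 / 2) := by
  have hya := abs_le.1 hy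
  have h0 := hasSum_cos_div_sq (hy.trans (by linarith [pi_pos]))
  have h1 := hasSum_cos_div_sq (y := y + a) (abs_le.2 ⟨by linarith, by linarith⟩)
  have h2 := hasSum_cos_div_sq (y := y - a) (abs_le.2 ⟨by linarith, by linarith⟩)
  -- The term at `0` is zero since `1 / 0 = 0`, so the index shift changes nothing.
  have h := (hasSum_nat_add_iff' 1).2 (((h0.mul_left 2).sub h1).sub h2)
  convert! h using 1
  · funext k
    push_cast
    rw [mul_add, mul_sub, cos_add, cos_sub, tentCoeff]
    ring
  · have := abs_add_add_abs_sub a y ha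
    have h3 : |y + a| = 2 * |y| + 2 * max 0 (a - |y|) - |y - a| := by linarith
    rw [h3]
    simp
    ring

theorem abs_sum_range_sub_le {u : ℕ → ℝ} {S C : ℝ} (hC : 0 ≤ C) (h : HasSum u S)
    (hu : ∀ k : ℕ, |u k| ≤ C / ((k : ℝ) + 1) ^ 2) {N : ℕ} (hN : N ≠ 0) :
    |∑ k ∈ Finset.range N, u k - S| ≤ C / N := by
  have hlim := (h.tendsto_sum_nat.const_sub (∑ k ∈ Finset.range N, u k)).abs
  refine le_of_tendsto hlim ?_
  filter_upwards [eventually_ge_atTop N] with n hn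
  rw [abs_sub_comm, ← Finset.sum_Ico_eq_sub _ hn]
  calc |∑ k ∈ Finset.Ico N n, u k| ≤ ∑ k ∈ Finset.Ico N n, C * (((k + 1 : ℕ) : ℝ) ^ 2)⁻¹ := by
        refine (Finset.abs_sum_le_sum_abs _ _).trans (Finset.sum_le_sum fun k _ => ?_)
        simpa [div_eq_mul_inv] using hu k
    _ = C * ∑ k ∈ Finset.Ioc N n, ((k : ℝ) ^ 2)⁻¹ := by
        rw [← Finset.mul_sum, Finset.sum_Ico_add' (fun k : ℕ => ((k : ℝ) ^ 2)⁻¹) N n 1]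
        exact congrArg _ (Finset.sum_congr (by ext; simp) fun _ _ => rfl)
    _ ≤ C * ((N : ℝ)⁻¹ - (n : ℝ)⁻¹) := by
        gcongr
        exact sum_Ioc_inv_sq_le_sub hN hn
    _ ≤ C * (N : ℝ)⁻¹ := by
        gcongr
        exact sub_le_self _ (by positivity)
    _ = C / N := rfl

/-- A trigonometric polynomial approximating `y ↦ max 0 (1 - |y| / a)` on `[-π, π]`. -/
noncomputable def tentPoly (a : ℝ) (N : ℕ) (y : ℝ) : ℝ :=
  (a ^ 2 / 2 + ∑ k ∈ Finset.range N, tentCoeff a k * cos ((k + 1) * y)) / (π * a)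

/-- As the coefficients are nonnegative, the full series at `y = 0`, whose normalized value is `1`,
dominates. The bound holds off `[-π, π]` too, where the polynomial no longer approximates the tent.
-/
theorem abs_tentPoly_le_one {a : ℝ} (ha : 0 < a) (ha' : a ≤ π) (N : ℕ) (y : ℝ) :
    |tentPoly a N y| ≤ 1 := by
  have h := hasSum_tentCoeff_mul_cos (y := 0) ha.le ha' (by simpa using pi_pos.le)
  simp only [mul_zero, cos_zero, mul_one, abs_zero, sub_zero, max_eq_right ha.le] at h
  have h1 := sum_le_hasSum (Finset.range N) (fun k _ => tentCoeff_nonneg a k) h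
  rw [tentPoly, abs_div, abs_of_pos (show 0 < π * a by positivity), div_le_one (by positivity)]
  have h2 : |∑ k ∈ Finset.range N, tentCoeff a k * cos ((k + 1) * y)| ≤
      ∑ k ∈ Finset.range N, tentCoeff a k := by
    refine (Finset.abs_sum_le_sum_abs _ _).trans (Finset.sum_le_sum fun k _ => ?_)
    rw [abs_mul, abs_of_nonneg (tentCoeff_nonneg a k)]
    exact mul_le_of_le_one_right (tentCoeff_nonneg a k) (abs_cos_le_one _)
  have h3 : |a ^ 2 / 2| = a ^ 2 / 2 := abs_of_nonneg (by positivity)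
  have := abs_add_le (a ^ 2 / 2) (∑ k ∈ Finset.range N, tentCoeff a k * cos ((k + 1) * y))
  linarith

theorem abs_tentPoly_sub_le {a y : ℝ} (ha : 0 < a) (ha' : a ≤ π) (hy : |y| ≤ π) {N : ℕ}
    (hN : N ≠ 0) : |tentPoly a N y - max 0 (1 - |y| / a)| ≤ 4 / (N * a) := by
  have h := hasSum_tentCoeff_mul_cos ha.le ha' hy
  have h1 := abs_sum_range_sub_le (by norm_num : (0 : ℝ) ≤ 4) h (fun k => by
    rw [abs_mul, abs_of_nonneg (tentCoeff_nonneg a k)]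
    exact (mul_le_of_le_one_right (tentCoeff_nonneg a k) (abs_cos_le_one _)).trans
      (tentCoeff_le a k)) hN
  have hmax : max 0 (a - |y|) = a * max 0 (1 - |y| / a) := by
    rw [mul_max_of_nonneg _ _ ha.le, mul_zero, mul_sub, mul_one, mul_div_cancel₀ _ ha.ne']
  rw [hmax] at h1
  have : tentPoly a N y - max 0 (1 - |y| / a) =
      (∑ k ∈ Finset.range N, tentCoeff a k * cos ((k + 1) * y) -
        (π * (a * max 0 (1 - |y| / a)) - a ^ 2 / 2)) / (π * a) := by
    rw [tentPoly]
    generalize max 0 (1 - |y| / a) = M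
    generalize ∑ k ∈ Finset.range N, tentCoeff a k * cos ((k + 1) * y) = S
    field_simp
    ring
  rw [this, abs_div, abs_of_pos (show 0 < π * a by positivity)]
  have hπ : 1 ≤ π := by linarith [pi_gt_three]
  calc _ ≤ 4 / N / (π * a) := by gcongr
    _ ≤ 4 / N / (1 * a) := by gcongr
    _ = _ := by rw [one_mul, div_div]

variable {ι : Type*} [Primcodable ι]

theorem ComputableRealSeq.tentCoeff {a : ι → ℝ} (ha : ComputableRealSeq a) {k : ι → ℕ}
    (hk : Computable k) : ComputableRealSeq fun i => tentCoeff (a i) (k i) := by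
  have hk1 : Computable fun i => k i + 1 := by fun_prop
  refine (((ComputableRealSeq.const_nat 1).sub ((ComputableRealSeq.natCast hk1).mul ha).cos).mul
    (.natCast_div (Computable.const 2) (show Computable fun i => (k i + 1) ^ 2 by fun_prop)
      (by simp))).congr fun i => ?_
  rw [PourElRichards.tentCoeff]
  push_cast
  ring

theorem ComputableRealSeq.inv_nat {A : ι → ℕ} (hA : Computable A) (hA0 : ∀ i, A i ≠ 0) :
    ComputableRealSeq fun i => ((A i : ℝ))⁻¹ :=
  (ComputableRealSeq.natCast_div (Computable.const 1) hA hA0).congr fun i => by simp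

/-- The tent series with `a = 1` at `y = 0` sums to `π - 1 / 2`, with remainder at most `4 / N`. -/
theorem computableRealSeq_pi : ComputableRealSeq fun _ : ι => π := by
  have hy : ComputableRealSeq fun i : ι × ℕ =>
      ((2 : ℕ) : ℝ)⁻¹ + ∑ k ∈ Finset.range (i.2 + 1), tentCoeff (1 : ℕ) k :=
    (ComputableRealSeq.inv_nat (Computable.const 2) (by simp)).add
      (((ComputableRealSeq.const_nat 1).tentCoeff (k := fun i : (ι × ℕ) × ℕ => i.2)
        (by fun_prop)).sum_range (n := fun i => i.2 + 1) (by fun_prop))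
  refine hy.of_limit (.natCast_div (Computable.const 4)
    (show Computable fun i : ι × ℕ => i.2 + 1 by fun_prop) (by simp)) (fun i n => ?_) fun i => ?_
  · have h := hasSum_tentCoeff_mul_cos (a := 1) (y := 0) zero_le_one
      (by linarith [pi_gt_three]) (by simpa using pi_pos.le)
    simp only [mul_zero, cos_zero, mul_one, abs_zero, sub_zero, max_eq_right zero_le_one] at h
    have h1 := abs_sum_range_sub_le (by norm_num : (0 : ℝ) ≤ 4) h (fun k => by
      rw [abs_of_nonneg (tentCoeff_nonneg 1 k)]
      exact tentCoeff_le 1 k) n.succ_ne_zero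
    push_cast
    push_cast at h1
    refine le_of_eq_of_le ?_ h1
    rw [Nat.succ_eq_add_one]
    congr 1
    ring
  · have := (tendsto_const_div_atTop_nhds_zero_nat (4 : ℝ)).comp (tendsto_add_atTop_nat 1)
    simpa [Function.comp_def] using this

/-- Search for `c` with `|c * 2⁻¹ ^ k * π - 1| < 4 * 2⁻¹ ^ k`; since `π < 4`, the floor of `2 ^ k /
π` qualifies. -/
theorem computableRealSeq_inv_pi : ComputableRealSeq fun _ : ι => π⁻¹ := by
  have hx : ComputableRealSeq fun i : (ι × ℕ) × ℕ =>
      |(i.2 : ℝ) * (2 : ℝ)⁻¹ ^ i.1.2 * π - (1 : ℕ)| - (4 : ℕ) * (2 : ℝ)⁻¹ ^ i.1.2 :=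
    ((((ComputableRealSeq.natCast (by fun_prop)).mul (.inv_two_pow (by fun_prop))).mul
      computableRealSeq_pi).sub (.const_nat 1)).abs.sub
      ((ComputableRealSeq.const_nat 4).mul (.inv_two_pow (by fun_prop)))
  have hε : ∀ k : ℕ, (0 : ℝ) < 2⁻¹ ^ k := fun k => by positivity
  obtain ⟨c, hc, h⟩ := hx.exists_neg (fun i => by
    refine ⟨⌊2 ^ i.2 / π⌋₊, ?_⟩
    have h1 := Nat.floor_le (show 0 ≤ 2 ^ i.2 / π by positivity)
    have h2 := Nat.lt_floor_add_one (2 ^ i.2 / π)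
    rw [le_div_iff₀ pi_pos] at h1
    rw [div_lt_iff₀ pi_pos] at h2
    have e : (2 : ℝ) ^ i.2 * 2⁻¹ ^ i.2 = 1 := by rw [← mul_pow]; norm_num
    have h1' := mul_le_mul_of_nonneg_right h1 (hε i.2).le
    have h2' := mul_lt_mul_of_pos_right h2 (hε i.2)
    have h4 := mul_lt_mul_of_pos_right pi_lt_four (hε i.2)
    rw [e] at h1' h2'
    rw [sub_neg, abs_lt]
    push_cast
    constructor <;> nlinarith [hε i.2])
  refine ((ComputableRealSeq.natCast hc).mul (.inv_two_pow (n := fun i : ι × ℕ => i.2)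
    (by fun_prop))).of_limit ((ComputableRealSeq.const_nat 4).mul
      (.inv_two_pow (n := fun i : ι × ℕ => i.2) (by fun_prop))) (fun i n => ?_) fun i => ?_
  · have h1 := sub_neg.1 (h (i, n))
    have e : (c (i, n) : ℝ) * 2⁻¹ ^ n - π⁻¹ = (c (i, n) * 2⁻¹ ^ n * π - (1 : ℕ)) * π⁻¹ := by
      have := pi_pos.ne'
      push_cast
      field_simp
    rw [e, abs_mul, abs_of_pos (inv_pos.2 pi_pos)]
    have hπ : π⁻¹ ≤ 1 := inv_le_one_of_one_le₀ (by linarith [pi_gt_three])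
    exact (mul_le_of_le_one_right (abs_nonneg _) hπ).trans h1.le
  · simpa using tendsto_inv_two_pow.const_mul 4

end Series

/-! ### Integer translates of the tent as a partition of unity. -/

section Tent

/-- The triangle function supported in `[-1, 1]`. -/
noncomputable def tent (u : ℝ) : ℝ := max 0 (1 - |u|)

@[fun_prop]
theorem continuous_tent : Continuous tent := by
  unfold tent
  fun_prop

theorem tent_nonneg (u : ℝ) : 0 ≤ tent u := le_max_left _ _

theorem tent_le_one (u : ℝ) : tent u ≤ 1 :=
  max_le zero_le_one (sub_le_self _ (abs_nonneg u))

theorem tent_eq_zero {u : ℝ} (h : 1 ≤ |u|) : tent u = 0 := max_eq_left (by linarith)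

theorem abs_tent_le_one (u : ℝ) : |tent u| ≤ 1 := by
  rw [abs_of_nonneg (tent_nonneg u)]
  exact tent_le_one u

theorem tent_eq_sub (u : ℝ) :
    tent u = max 0 (min 1 (u + 1)) - max 0 (min 1 u) := by
  unfold tent
  grind

/-- By `tent_eq_sub` each tent is a difference of consecutive ramps, so the sum telescopes. -/
theorem sum_tent (n : ℕ) (v : ℝ) : ∑ j ∈ Finset.range n, tent (v - j) =
    max 0 (min 1 (v + 1)) - max 0 (min 1 (v + 1 - n)) := by
  induction n with
  | zero => simp
  | succ n ih =>
    rw [Finset.sum_range_succ, ih, tent_eq_sub]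
    push_cast
    ring_nf

theorem sum_tent_le_one (n : ℕ) (v : ℝ) : ∑ j ∈ Finset.range n, tent (v - j) ≤ 1 := by
  rw [sum_tent]
  have h1 : max 0 (min 1 (v + 1)) ≤ 1 := max_le zero_le_one (min_le_left _ _)
  have h2 : 0 ≤ max 0 (min 1 (v + 1 - n)) := le_max_left _ _
  linarith

theorem sum_tent_eq_one {n : ℕ} {v : ℝ} (h0 : 0 ≤ v) (h : v + 1 ≤ n) :
    ∑ j ∈ Finset.range n, tent (v - j) = 1 := by
  rw [sum_tent, min_eq_left (by linarith), max_eq_right zero_le_one,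
    max_eq_left ((min_le_right _ _).trans (by linarith)), sub_zero]

end Tent

/-! ### Approximation by trigonometric polynomials and by dyadic tents. -/

section Approximation

open Real

theorem abs_integral_sub_le (μ : Measure ℝ) [IsProbabilityMeasure μ] {F G : ℝ → ℝ} {ε T : ℝ}
    (hF : Continuous F) (hG : Continuous G) (hF1 : ∀ x, |F x| ≤ 1) (hG1 : ∀ x, |G x| ≤ 1)
    (hε : 0 ≤ ε) (h : ∀ x, |x| ≤ T → |F x - G x| ≤ ε) :
    |∫ x, F x ∂μ - ∫ x, G x ∂μ| ≤ ε + 2 * μ.real {x | T < |x|} := by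
  have hs : MeasurableSet {x : ℝ | T < |x|} := measurableSet_lt measurable_const (by fun_prop)
  have hind : Integrable ({x : ℝ | T < |x|}.indicator fun _ => (2 : ℝ)) μ :=
    (integrable_const _).indicator hs
  rw [← integral_sub (integrable_of_abs_le hF hF1) (integrable_of_abs_le hG hG1),
    ← Real.norm_eq_abs]
  calc _ ≤ ∫ x, (ε + {x : ℝ | T < |x|}.indicator (fun _ => (2 : ℝ)) x) ∂μ := by
        refine norm_integral_le_of_norm_le ((integrable_const _).add hind) (.of_forall fun x => ?_)
        by_cases hx : T < |x|
        · have := abs_sub (F x) (G x)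
          have h1 := hF1 x
          have h2 := hG1 x
          rw [Set.indicator_of_mem (show x ∈ {x : ℝ | T < |x|} from hx), Real.norm_eq_abs]
          linarith
        · rw [Set.indicator_of_notMem (show x ∉ {x : ℝ | T < |x|} from hx), add_zero]
          exact h x (not_lt.1 hx)
    _ = _ := by
        rw [integral_add (integrable_const _) hind, integral_indicator_const _ hs]
        simp [mul_comm]

theorem continuous_tentPoly (a : ℝ) (N : ℕ) : Continuous (tentPoly a N) := by
  unfold tentPoly
  fun_prop

/-- Rescaling by `R` puts `[-T, T]` inside one period and keeps the frequencies `(k + 1) / R`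
rational. The width `a = 1 / (2 ^ d * R)` matches the tent, and the number `N` of terms makes `4 /
(N * a) = 2⁻¹ ^ n`. -/
theorem abs_integral_tentPoly_sub_le (μ : Measure ℝ) [IsProbabilityMeasure μ] {x₀ T : ℝ}
    {R d n : ℕ} (hR : R ≠ 0) (hT : T + |x₀| ≤ R) :
    |∫ x, tentPoly ((2 ^ d * R : ℕ) : ℝ)⁻¹ (4 * (2 ^ d * R) * 2 ^ n) ((x - x₀) / R) ∂μ -
      ∫ x, tent (2 ^ d * (x - x₀)) ∂μ| ≤ (2 : ℝ)⁻¹ ^ n + 2 * μ.real {x | T < |x|} := by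
  have hR0 : (0 : ℝ) < R := by positivity
  have hA : 0 < 2 ^ d * R := by positivity
  have ha : (0 : ℝ) < ((2 ^ d * R : ℕ) : ℝ)⁻¹ := by positivity
  have ha' : ((2 ^ d * R : ℕ) : ℝ)⁻¹ ≤ π :=
    (inv_le_one_of_one_le₀ (by exact_mod_cast hA)).trans (by linarith [pi_gt_three])
  refine abs_integral_sub_le μ ((continuous_tentPoly _ _).comp (by fun_prop)) (by fun_prop)
    (fun x => abs_tentPoly_le_one ha ha' _ _) (fun x => abs_tent_le_one _) (by positivity)
    fun x hx => ?_
  have hy : |(x - x₀) / R| ≤ π := by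
    rw [abs_div, Nat.abs_cast, div_le_iff₀ hR0]
    have h1 := abs_sub x x₀
    have h2 : 1 * (R : ℝ) ≤ π * R := by
      gcongr
      linarith [pi_gt_three]
    linarith
  refine le_trans (le_of_eq ?_)
    ((abs_tentPoly_sub_le ha ha' hy (N := 4 * (2 ^ d * R) * 2 ^ n) (by positivity)).trans
      (le_of_eq ?_))
  · congr 2
    rw [tent, abs_div, abs_mul, Nat.abs_cast, abs_of_pos (show (0 : ℝ) < 2 ^ d by positivity)]
    congr 2
    push_cast
    field_simp
  · rw [inv_pow]
    push_cast
    field_simp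

theorem integral_tentPoly (μ : Measure ℝ) [IsProbabilityMeasure μ] (a x₀ R : ℝ) (N : ℕ) :
    ∫ x, tentPoly a N ((x - x₀) / R) ∂μ =
      (a ^ 2 / 2 + ∑ k ∈ Finset.range N, tentCoeff a k *
        (cos ((k + 1) * (x₀ / R)) * (charFun μ ((k + 1) / R)).re +
          sin ((k + 1) * (x₀ / R)) * (charFun μ ((k + 1) / R)).im)) / (π * a) := by
  have hc : ∀ t : ℝ, Integrable (fun x => cos (t * x)) μ := fun t =>
    integrable_of_abs_le (by fun_prop) fun x => abs_cos_le_one _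
  have hs : ∀ t : ℝ, Integrable (fun x => sin (t * x)) μ := fun t =>
    integrable_of_abs_le (by fun_prop) fun x => abs_sin_le_one _
  have hterm : ∀ (k : ℕ) (x : ℝ), tentCoeff a k * cos ((k + 1) * ((x - x₀) / R)) =
      tentCoeff a k * (cos ((k + 1) * (x₀ / R)) * cos ((k + 1) / R * x) +
        sin ((k + 1) * (x₀ / R)) * sin ((k + 1) / R * x)) := fun k x => by
    have : (k + 1) * ((x - x₀) / R) = (k + 1) / R * x - (k + 1) * (x₀ / R) := by ring
    rw [this, cos_sub]
    ring
  have hint : ∀ k : ℕ, Integrable (fun x =>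
      tentCoeff a k * (cos ((k + 1) * (x₀ / R)) * cos ((k + 1) / R * x) +
        sin ((k + 1) * (x₀ / R)) * sin ((k + 1) / R * x))) μ := fun k =>
    (((hc _).const_mul _).add ((hs _).const_mul _)).const_mul _
  simp only [tentPoly, hterm]
  rw [integral_div, integral_add (integrable_const _) (integrable_finsetSum _ fun k _ => hint k),
    integral_finsetSum _ fun k _ => hint k]
  congr 2
  · simp
  · refine Finset.sum_congr rfl fun k _ => ?_
    rw [integral_const_mul, integral_add ((hc _).const_mul _) ((hs _).const_mul _),
      integral_const_mul, integral_const_mul, re_charFun, im_charFun]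

/-- Piecewise linear interpolation on the grid of mesh `2⁻¹ ^ d` in `[-L, L]`: only nodes within one
mesh of `x` contribute. Such an `x` may lie outside `[-L, L]`, hence the modulus on `[-(L + 1), L +
1]`. -/
theorem abs_sum_mul_tent_sub_le {f : ℝ → ℝ} {L d : ℕ} {ε : ℝ} (hε : 0 ≤ ε)
    (hf : ∀ x y : ℝ, |x - y| < (2 : ℝ)⁻¹ ^ d → |x| ≤ L + 1 → |y| ≤ L + 1 → |f x - f y| ≤ ε)
    (hL : ∀ x, (L : ℝ) ≤ |x| → f x = 0) (x : ℝ) :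
    |∑ j ∈ Finset.range (2 * (L * 2 ^ d) + 1),
      f ((j - (L * 2 ^ d : ℕ)) / 2 ^ d) * tent (2 ^ d * x - (j - (L * 2 ^ d : ℕ))) - f x| ≤ ε := by
  set c := L * 2 ^ d with hc
  have hd : (0 : ℝ) < 2 ^ d := by positivity
  have hcL : (c : ℝ) = L * 2 ^ d := by simp [hc]
  have hshift : ∀ j : ℕ, tent (2 ^ d * x - (j - c)) = tent (2 ^ d * x + c - j) := fun j => by
    congr 1
    ring
  -- The tents sum to `1` when `|x| < L`; elsewhere `f x = 0`.
  have hfx : f x * ∑ j ∈ Finset.range (2 * c + 1), tent (2 ^ d * x - (j - c)) = f x := by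
    rcases le_or_gt (L : ℝ) |x| with hx | hx
    · rw [hL x hx, zero_mul]
    · obtain ⟨h1, h2⟩ := abs_lt.1 hx
      have h1' := mul_lt_mul_of_pos_right h1 hd
      have h2' := mul_lt_mul_of_pos_right h2 hd
      simp only [hshift]
      rw [sum_tent_eq_one (by linarith) (by push_cast; linarith), mul_one]
  rw [← hfx, Finset.mul_sum, ← Finset.sum_sub_distrib]
  simp only [← sub_mul]
  calc _ ≤ ∑ j ∈ Finset.range (2 * c + 1), ε * tent (2 ^ d * x - (j - c)) := by
        refine (Finset.abs_sum_le_sum_abs _ _).trans (Finset.sum_le_sum fun j hj => ?_)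
        rw [abs_mul, abs_of_nonneg (tent_nonneg _)]
        rcases le_or_gt 1 |2 ^ d * x - (j - c)| with h | h
        · rw [tent_eq_zero h, mul_zero, mul_zero]
        · refine mul_le_mul_of_nonneg_right ?_ (tent_nonneg _)
          have hj' : (j : ℝ) ≤ 2 * c := by
            have := Finset.mem_range.1 hj
            exact_mod_cast Nat.lt_succ_iff.1 this
          have hj0 : (0 : ℝ) ≤ j := by positivity
          have hxj : |((j : ℝ) - c) / 2 ^ d| ≤ L := by
            rw [abs_div, abs_of_pos hd, div_le_iff₀ hd, ← hcL, abs_le]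
            constructor <;> linarith
          have hclose : |((j : ℝ) - c) / 2 ^ d - x| < 2⁻¹ ^ d := by
            have : ((j : ℝ) - c) / 2 ^ d - x = -(2 ^ d * x - (j - c)) / 2 ^ d := by
              field_simp
              ring
            rw [this, abs_div, abs_neg, abs_of_pos hd, inv_pow, ← one_div]
            gcongr
          have h1 : (2 : ℝ)⁻¹ ^ d ≤ 1 := pow_le_one₀ (by norm_num) (by norm_num)
          refine hf _ _ hclose (by linarith) ?_
          have := abs_sub_abs_le_abs_sub x (((j : ℝ) - c) / 2 ^ d)
          rw [abs_sub_comm] at this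
          linarith
    _ ≤ ε := by
        rw [← Finset.mul_sum]
        simp only [hshift]
        exact mul_le_of_le_one_right hε (sum_tent_le_one _ _)

end Approximation

/-! ### Computable characteristic functions come from computable distributions. -/

section Backward

open Filter Topology

variable {μ : ℕ → ProbabilityMeasure ℝ}

/-- Effective tightness of a sequence of distributions with effectively continuous characteristic
functions. -/
theorem exists_computable_tight
    (hφ : EffectivelyContinuous fun m t => charFun (μ m : Measure ℝ) t) :
    ∃ T : ℕ × ℕ → ℕ, Computable T ∧
      ∀ m n, (μ m : Measure ℝ).real {x | (T (m, n) : ℝ) < |x|} ≤ (2 : ℝ)⁻¹ ^ n := by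
  obtain ⟨α, hα, h⟩ := hφ
  -- Then `2 / T = 2⁻¹ ^ (α + 1)` is strictly below the modulus at `0`, so `|1 - φ| < 2⁻¹ ^ (n + 1)`
  -- on the interval of integration of length `4 / T`; the prefactor `T / 2` leaves `2⁻¹ ^ n`.
  refine ⟨fun p => 2 ^ (α (p.1, 1, p.2 + 1) + 2), by fun_prop, fun m n => ?_⟩
  set a := α (m, 1, n + 1)
  have hT : (0 : ℝ) < ((2 ^ (a + 2) : ℕ) : ℝ) := by positivity
  set T := ((2 ^ (a + 2) : ℕ) : ℝ) with hTdef
  have hTinv : 2 * T⁻¹ = 2⁻¹ ^ (a + 1) := by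
    rw [hTdef, inv_pow]
    push_cast
    rw [pow_succ 2 (a + 1)]
    field_simp
  have hlt : (2 : ℝ)⁻¹ ^ (a + 1) < 2⁻¹ ^ a :=
    pow_lt_pow_right_of_lt_one₀ (by norm_num) (by norm_num) (Nat.lt_succ_self a)
  have hle : (2 : ℝ)⁻¹ ^ (a + 1) ≤ 1 := pow_le_one₀ (by norm_num) (by norm_num)
  have hb : ‖∫ t in (-2 * T⁻¹)..(2 * T⁻¹), 1 - charFun (μ m : Measure ℝ) t‖ ≤
      (2 : ℝ)⁻¹ ^ (n + 1) * |2 * T⁻¹ - -2 * T⁻¹| := by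
    refine intervalIntegral.norm_integral_le_of_norm_le_const fun t ht => ?_
    rw [Set.uIoc_of_le (by have := inv_pos.2 hT; linarith)] at ht
    have ht' : |t| ≤ 2⁻¹ ^ (a + 1) := by
      rw [← hTinv, abs_le]
      exact ⟨by linarith [ht.1], ht.2⟩
    have := h m 1 (n + 1) t 0 (by rw [sub_zero]; exact ht'.trans_lt hlt)
      (by push_cast; exact ht'.trans hle) (by simp)
    rw [norm_sub_rev]
    simpa using this.le
  refine (measureReal_abs_gt_le_integral_charFun hT).trans ?_
  calc _ ≤ 2⁻¹ * T * ((2 : ℝ)⁻¹ ^ (n + 1) * |2 * T⁻¹ - -2 * T⁻¹|) := by gcongr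
    _ = 2⁻¹ ^ n := by
        have : 2 * T⁻¹ - -2 * T⁻¹ = 4 * T⁻¹ := by ring
        rw [this, abs_of_pos (by positivity), pow_succ]
        field_simp
        norm_num

theorem ComputableComplexFunSeq.comp_div {φ : ℕ → ℝ → ℂ} (hφ : ComputableComplexFunSeq φ)
    {ι : Type*} [Primcodable ι] {m k R : ι → ℕ} (hm : Computable m) (hk : Computable k)
    (hR : Computable R) (hR0 : ∀ i, R i ≠ 0) :
    ComputableRealSeq (fun i => (φ (m i) ((k i + 1) / R i)).re) ∧
      ComputableRealSeq fun i => (φ (m i) ((k i + 1) / R i)).im := by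
  -- Sequential computability takes points indexed by `ℕ`, so all positive rationals are enumerated
  -- once and the needed ones selected by a recursive index.
  have hx : ComputableRealSeq fun i : ℕ =>
      ((i.unpair.1 + 1 : ℕ) : ℝ) / ((i.unpair.2 + 1 : ℕ) : ℝ) :=
    .natCast_div (by fun_prop) (by fun_prop) (by simp)
  have h := hφ.sequentially_computable _ hx
  have hg : Computable fun i => (m i, Nat.pair (k i) (R i - 1)) := by fun_prop
  have e : ∀ i, ((R i - 1 : ℕ) : ℝ) + 1 = R i := fun i => by
    exact_mod_cast Nat.sub_add_cancel (Nat.one_le_iff_ne_zero.2 (hR0 i))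
  exact ⟨(h.re.comp hg).congr fun i => by simp [e], (h.im.comp hg).congr fun i => by simp [e]⟩

theorem computableRealSeq_integral_tent
    (hφ : ComputableComplexFunSeq fun m t => charFun (μ m : Measure ℝ) t) :
    ComputableRealSeq fun i : ℕ × ℕ × ℕ × ℕ =>
      ∫ x, tent (2 ^ i.2.1 * x - (i.2.2.1 - i.2.2.2)) ∂(μ i.1 : Measure ℝ) := by
  obtain ⟨T, hT, hTμ⟩ := exists_computable_tight hφ.effectively_continuous
  -- The indices are `((m, d, j, c), n)`. The tent is centred at `x₀ = (j - c) / 2 ^ d`, so `|x₀| ≤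
  -- j + c` and `T + |x₀| ≤ R`. Below, `θ` is `(k + 1) * x₀ / R`.
  let R : (ℕ × ℕ × ℕ × ℕ) × ℕ → ℕ := fun i => T (i.1.1, i.2) + i.1.2.2.1 + i.1.2.2.2 + 1
  let A : (ℕ × ℕ × ℕ × ℕ) × ℕ → ℕ := fun i => 2 ^ i.1.2.1 * R i
  have hR : Computable R := by fun_prop
  have hA : Computable A := by fun_prop
  have hA0 : ∀ i, A i ≠ 0 := fun i => by positivity
  have hAinv := ComputableRealSeq.inv_nat hA hA0
  let θ : ((ℕ × ℕ × ℕ × ℕ) × ℕ) × ℕ → ℝ := fun i =>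
    ((i.2 + 1 : ℕ) : ℝ) * (((i.1.1.2.2.1 : ℝ) - i.1.1.2.2.2) * (A i.1 : ℝ)⁻¹)
  have hθ : ComputableRealSeq θ :=
    (ComputableRealSeq.natCast (by fun_prop)).mul
      (((ComputableRealSeq.natCast (by fun_prop)).sub (.natCast (by fun_prop))).mul
        (hAinv.comp (g := Prod.fst) (by fun_prop)))
  obtain ⟨hre, him⟩ := hφ.comp_div (ι := ((ℕ × ℕ × ℕ × ℕ) × ℕ) × ℕ) (m := fun i => i.1.1.1)
    (k := fun i => i.2) (R := fun i => R i.1) (by fun_prop) (by fun_prop) (by fun_prop)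
    (fun i => Nat.succ_ne_zero _)
  have hsum := (((hAinv.comp (g := Prod.fst) (by fun_prop)).tentCoeff
    (k := Prod.snd) (by fun_prop)).mul ((hθ.cos.mul hre).add (hθ.sin.mul him))).sum_range
      (n := fun i => 4 * A i * 2 ^ i.2) (by fun_prop)
  have hy := (((hAinv.pow (Computable.const 2)).mul
    (.inv_nat (Computable.const 2) (by simp))).add hsum).mul
      (computableRealSeq_inv_pi.mul (.natCast hA))
  -- The series error `2⁻¹ ^ n` plus twice the tail bound `2⁻¹ ^ n`.
  refine hy.of_limit ((ComputableRealSeq.const_nat 3).mul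
    (.inv_two_pow (n := Prod.snd) (by fun_prop))) ?_ fun i => ?_
  · rintro ⟨m, d, j, c⟩ n
    have hR0 : R ((m, d, j, c), n) ≠ 0 := Nat.succ_ne_zero _
    have hAv : A ((m, d, j, c), n) = 2 ^ d * R ((m, d, j, c), n) := rfl
    have hx₀ : |((j : ℝ) - c) / 2 ^ d| ≤ j + c := by
      rw [abs_div, abs_of_pos (show (0 : ℝ) < 2 ^ d by positivity)]
      refine (div_le_self (abs_nonneg _) (one_le_pow₀ (by norm_num))).trans ?_
      simpa using abs_sub (j : ℝ) c
    have h := abs_integral_tentPoly_sub_le (μ m : Measure ℝ) (x₀ := ((j : ℝ) - c) / 2 ^ d)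
      (T := T (m, n)) (d := d) (n := n) hR0 (by
        simp only [R]
        push_cast
        linarith)
    rw [integral_tentPoly, ← hAv] at h
    have hx : (((j : ℝ) - c) / 2 ^ d) / R ((m, d, j, c), n) =
        ((j : ℝ) - c) * (A ((m, d, j, c), n) : ℝ)⁻¹ := by
      rw [hAv]
      push_cast
      field_simp
    rw [hx] at h
    have ht : ∀ x : ℝ, 2 ^ d * (x - ((j : ℝ) - c) / 2 ^ d) = 2 ^ d * x - (j - c) := fun x => by
      field_simp
    simp only [ht] at h
    have hμ := hTμ m n
    refine le_trans (le_of_eq ?_) (h.trans ?_)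
    · congr 2
      simp only [θ, div_eq_mul_inv, mul_inv, inv_inv]
      push_cast
      rfl
    · push_cast
      linarith
  · simpa using tendsto_inv_two_pow.const_mul 3

theorem EffectivelyContinuous.continuous {E : Type*} [NormedAddCommGroup E] {f : ℕ → ℝ → E}
    (hf : EffectivelyContinuous f) (n : ℕ) : Continuous (f n) := by
  obtain ⟨α, -, h⟩ := hf
  refine continuous_iff_continuousAt.2 fun x => Metric.continuousAt_iff.2 fun ε hε => ?_
  obtain ⟨L, hL⟩ := exists_nat_ge (|x| + 1)
  obtain ⟨k, hk⟩ := exists_pow_lt_of_lt_one hε (show (2 : ℝ)⁻¹ < 1 by norm_num)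
  refine ⟨2⁻¹ ^ α (n, L, k), by positivity, fun {y} hy => ?_⟩
  rw [Real.dist_eq] at hy
  rw [dist_eq_norm]
  have h1 : (2 : ℝ)⁻¹ ^ α (n, L, k) ≤ 1 := pow_le_one₀ (by norm_num) (by norm_num)
  have h2 := abs_sub_abs_le_abs_sub y x
  exact (h n L k y x hy (by linarith) (by linarith)).trans hk

theorem computableDistributionSeq_of_charFun
    (hφ : ComputableComplexFunSeq fun m t => charFun (μ m : Measure ℝ) t) :
    ComputableDistributionSeq μ := by
  rintro f L ⟨hf, hL, hfL⟩
  have hcont := hf.effectively_continuous.continuous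
  obtain ⟨α, hα, hfα⟩ := hf.effectively_continuous
  let d : (ℕ × ℕ) × ℕ → ℕ := fun i => α (i.1.2, L i.1.2 + 1, i.2)
  have hd : Computable d := by fun_prop
  let c : (ℕ × ℕ) × ℕ → ℕ := fun i => L i.1.2 * 2 ^ d i
  have hc : Computable c := by fun_prop
  have hX : ComputableRealSeq fun i : ℕ => ((i.unpair.1 : ℝ) - i.unpair.2.unpair.1) *
      ((2 ^ i.unpair.2.unpair.2 : ℕ) : ℝ)⁻¹ :=
    ((ComputableRealSeq.natCast (by fun_prop)).sub (.natCast (by fun_prop))).mul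
      (.inv_nat (by fun_prop) (by simp))
  have hfX := (hf.sequentially_computable _ hX).comp (κ := ((ℕ × ℕ) × ℕ) × ℕ)
    (g := fun i => (i.1.1.2, Nat.pair i.2 (Nat.pair (c i.1) (d i.1)))) (by fun_prop)
  have hI := (computableRealSeq_integral_tent hφ).comp (κ := ((ℕ × ℕ) × ℕ) × ℕ)
    (g := fun i => (i.1.1.1, d i.1, i.2, c i.1)) (by fun_prop)
  refine ((hfX.mul hI).sum_range (n := fun i => 2 * c i + 1) (by fun_prop)).of_limit
    (.inv_two_pow (n := Prod.snd) (by fun_prop)) ?_ fun i => tendsto_inv_two_pow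
  rintro ⟨m, n⟩ k
  have hfi : Integrable (f n) (μ m : Measure ℝ) :=
    (hcont n).integrable_of_hasCompactSupport (.intro
      (isCompact_Icc (a := -(L n : ℝ)) (b := L n)) fun x hx => hfL n x (by
        by_contra h
        exact hx (abs_le.1 (not_le.1 h).le)))
  have hti : ∀ j : ℕ, Integrable (fun x => f n ((j - (c ((m, n), k) : ℕ)) / 2 ^ d ((m, n), k)) *
      tent (2 ^ d ((m, n), k) * x - (j - (c ((m, n), k) : ℕ)))) (μ m : Measure ℝ) := fun j =>
    (integrable_of_abs_le (by fun_prop) fun x => abs_tent_le_one _).const_mul _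
  have hb := abs_sum_mul_tent_sub_le (f := f n) (L := L n) (d := d ((m, n), k))
    (ε := 2⁻¹ ^ k) (by positivity)
    (fun x y hxy hx hy => (hfα n (L n + 1) k x y hxy (by exact_mod_cast hx)
      (by exact_mod_cast hy)).le) (hfL n)
  simp only [← Real.norm_eq_abs] at hb
  have h1 := norm_integral_le_of_norm_le_const (μ := (μ m : Measure ℝ)) (.of_forall hb)
  rw [integral_sub (integrable_finsetSum _ fun j _ => hti j) hfi,
    integral_finsetSum _ fun j _ => hti j] at h1
  simp only [integral_const_mul] at h1
  simpa [div_eq_mul_inv] using h1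

end Backward

end PourElRichards

theorem theorem4p6 (μ : ℕ → ProbabilityMeasure ℝ) :
    PourElRichards.ComputableDistributionSeq μ ↔
      PourElRichards.ComputableComplexFunSeq (fun m t => charFun (μ m : Measure ℝ) t) :=
  ⟨fun h => h.computable_charFun, PourElRichards.computableDistributionSeq_of_charFun⟩
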